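/- Let $d\ge 2$. All functions and sets below are Borel measurable; "increasing" and "decreasing" are meant in the non-strict sense; inequalities between vectors are componentwise. For a random vector $\mathbf X=(X_1,\dots,X_d)$ write $\mathbf X_A=(X_k)_{k\in A}$ for $A\subseteq\{1,\dots,d\}$ and $\mathbf X_{-i}=(X_k)_{k\ne i}$; a set $S$ is decreasing if $\mathbf x\in S$ and $\mathbf y\le\mathbf x$ imply $\mathbf y\in S$. The vector $\mathbf X$ is - PA (resp. NA) if $\mathrm{Cov}(f(\mathbf X_A),g(\mathbf X_B))\ge 0$ for all $A,B\subseteq\{1,\dots,d\}$ (resp. $\le 0$ for all disjoint $A,B$) and all $f,g$ that are both coordinatewise increasing or both coordinatewise decreasing, whenever the covariance exists; - PRD (resp. NRD) if for every $i$ and every coordinatewise increasing $g$ with $g(\mathbf X_{-i})$ integrable, $\mathbb E[g(\mathbf X_{-i})\mid X_i]$ is almost surely an increasing (resp. decreasing) function of $X_i$; - WPA (resp. WNA) if $\mathbb P(\mathbf X_{-i}\in S\mid X_i\le x)\ge\mathbb P(\mathbf X_{-i}\in S)$ (resp. $\le$) for every $i$, every decreasing $S\subseteq\mathbb R^{d-1}$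 and every $x\in\mathbb R$ with $\mathbb P(X_i\le x)>0$; - POD (resp. NOD) if $\mathbb P(\mathbf X\le\mathbf x)\ge\prod_i\mathbb P(X_i\le x_i)$ and $\mathbb P(\mathbf X>\mathbf x)\ge\prod_i\mathbb P(X_i>x_i)$ (resp. both with $\le$) for all $\mathbf x\in\mathbb R^d$; - IN if $X_1,\dots,X_d$ are independent. For $\mathfrak D$ one of PA, PRD, WPA, POD, NA, NRD, WNA, NOD, IN, let $\mathcal F_{\mathfrak D}$ be the class of probability distributions $F$ on $\mathbb R$ such that, whenever $X,X_1,\dots,X_d$ all have distribution $F$ and $(X_1,\dots,X_d)$ satisfies $\mathfrak D$, $$\mathbb P(X>x)\le \mathbb P\Big(\sum_{i=1}^d\theta_iX_i>x\Big)\quad\text{for all }x\in\mathbb R\text{ and all }(\theta_1,\dots,\theta_d)\in[0,1]^d\text{ with }\theta_1+\dots+\theta_d=1 .$$ Then each class $\mathcal F_{\mathfrak D}$ is closed under increasing convex transforms: if the distribution of a random variable $X$ is in $\mathcal F_{\mathfrak D}$, and $f$ is a real function that is (not necessarily strictly) increasing and convex on an interval $I\subseteq\mathbb R$ with $\mathbb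 P(X\in I)=1$ (for instance $I=\mathbb R$), then the distribution of $f(X)$ is in $\mathcal F_{\mathfrak D}$. -/

import Mathlib

namespace DiversificationPenalty

open MeasureTheory ProbabilityTheory

section Dependence

variable {Ω : Type*} [MeasurableSpace Ω] {d : ℕ}

/-- The subvector `X_A = (X_k)_{k ∈ A}` of a random vector. -/
def sub (X : Fin d → Ω → ℝ) (A : Set (Fin d)) (ω : Ω) : A → ℝ := fun k => X k ω

/-- The vector `X_{-i}`, in which the coordinate `i` is omitted. -/
def drop (X : Fin d → Ω → ℝ) (i : Fin d) (ω : Ω) : {k : Fin d // k ≠ i} → ℝ :=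
  fun k => X k ω

/-- The functions `f` and `g` are both coordinatewise increasing or both coordinatewise decreasing
(`Monotone` and `Antitone` refer to the componentwise order). -/
def SameMonotonicity {α β : Type*} (f : (α → ℝ) → ℝ) (g : (β → ℝ) → ℝ) : Prop :=
  (Monotone f ∧ Monotone g) ∨ (Antitone f ∧ Antitone g)

/-- The covariance of `U` and `V` exists. -/
def CovExists (P : Measure Ω) (U V : Ω → ℝ) : Prop :=
  Integrable U P ∧ Integrable V P ∧ Integrable (fun ω => U ω * V ω) P

/-- Positively associated. -/
def PA (P : Measure Ω) (X : Fin d → Ω → ℝ) : Prop :=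
  ∀ (A B : Set (Fin d)) (f : (A → ℝ) → ℝ) (g : (B → ℝ) → ℝ),
    Measurable f → Measurable g → SameMonotonicity f g →
    CovExists P (fun ω => f (sub X A ω)) (fun ω => g (sub X B ω)) →
    0 ≤ covariance (fun ω => f (sub X A ω)) (fun ω => g (sub X B ω)) P

/-- Negatively associated. -/
def NA (P : Measure Ω) (X : Fin d → Ω → ℝ) : Prop :=
  ∀ (A B : Set (Fin d)), Disjoint A B → ∀ (f : (A → ℝ) → ℝ) (g : (B → ℝ) → ℝ),
    Measurable f → Measurable g → SameMonotonicity f g →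
    CovExists P (fun ω => f (sub X A ω)) (fun ω => g (sub X B ω)) →
    covariance (fun ω => f (sub X A ω)) (fun ω => g (sub X B ω)) P ≤ 0

/-- The conditional expectation `E[g(X_{-i}) | X_i]`. -/
noncomputable def condExpDrop (P : Measure Ω) (X : Fin d → Ω → ℝ) (i : Fin d)
    (g : ({k : Fin d // k ≠ i} → ℝ) → ℝ) : Ω → ℝ :=
  condExp (MeasurableSpace.comap (X i) inferInstance) P (fun ω => g (drop X i ω))

/-- Positively regression dependent. A conditional expectation is only determined almost surely,
so "increasing function of `X_i`" means: almost surely equal to `φ (X_i)`, with `φ` increasing on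
a Borel set `S` such that `X_i ∈ S` almost surely. (One cannot take `S = ℝ`: if `X_i` is bounded,
then `φ` may tend to infinity at the end of the range of `X_i`.) -/
def PRD (P : Measure Ω) (X : Fin d → Ω → ℝ) : Prop :=
  ∀ (i : Fin d) (g : ({k : Fin d // k ≠ i} → ℝ) → ℝ), Measurable g → Monotone g →
    Integrable (fun ω => g (drop X i ω)) P →
    ∃ (S : Set ℝ) (φ : ℝ → ℝ), MeasurableSet S ∧ (∀ᵐ ω ∂P, X i ω ∈ S) ∧ MonotoneOn φ S ∧
      ∀ᵐ ω ∂P, condExpDrop P X i g ω = φ (X i ω)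

/-- Negatively regression dependent; see `PRD`. -/
def NRD (P : Measure Ω) (X : Fin d → Ω → ℝ) : Prop :=
  ∀ (i : Fin d) (g : ({k : Fin d // k ≠ i} → ℝ) → ℝ), Measurable g → Monotone g →
    Integrable (fun ω => g (drop X i ω)) P →
    ∃ (S : Set ℝ) (φ : ℝ → ℝ), MeasurableSet S ∧ (∀ᵐ ω ∂P, X i ω ∈ S) ∧ AntitoneOn φ S ∧
      ∀ᵐ ω ∂P, condExpDrop P X i g ω = φ (X i ω)

/-- Weakly positively associated. Here `cond P B A` is `P(A | B)`, and `IsLowerSet` is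
"decreasing set". -/
def WPA (P : Measure Ω) (X : Fin d → Ω → ℝ) : Prop :=
  ∀ (i : Fin d) (S : Set ({k : Fin d // k ≠ i} → ℝ)), MeasurableSet S → IsLowerSet S →
    ∀ x : ℝ, 0 < P {ω | X i ω ≤ x} →
      P {ω | drop X i ω ∈ S} ≤ cond P {ω | X i ω ≤ x} {ω | drop X i ω ∈ S}

/-- Weakly negatively associated. -/
def WNA (P : Measure Ω) (X : Fin d → Ω → ℝ) : Prop :=
  ∀ (i : Fin d) (S : Set ({k : Fin d // k ≠ i} → ℝ)), MeasurableSet S → IsLowerSet S →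
    ∀ x : ℝ, 0 < P {ω | X i ω ≤ x} →
      cond P {ω | X i ω ≤ x} {ω | drop X i ω ∈ S} ≤ P {ω | drop X i ω ∈ S}

/-- Positively orthant dependent. -/
def POD (P : Measure Ω) (X : Fin d → Ω → ℝ) : Prop :=
  ∀ x : Fin d → ℝ,
    ∏ i, P {ω | X i ω ≤ x i} ≤ P {ω | ∀ i, X i ω ≤ x i} ∧
    ∏ i, P {ω | x i < X i ω} ≤ P {ω | ∀ i, x i < X i ω}

/-- Negatively orthant dependent. -/
def NOD (P : Measure Ω) (X : Fin d → Ω → ℝ) : Prop :=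
  ∀ x : Fin d → ℝ,
    P {ω | ∀ i, X i ω ≤ x i} ≤ ∏ i, P {ω | X i ω ≤ x i} ∧
    P {ω | ∀ i, x i < X i ω} ≤ ∏ i, P {ω | x i < X i ω}

end Dependence

/-- The dependence concepts; `IN` is independence. -/
inductive Concept
  | PA | PRD | WPA | POD | NA | NRD | WNA | NOD | IN

/-- The random vector `X` satisfies the dependence concept. -/
def Concept.Satisfies {Ω : Type*} [MeasurableSpace Ω] {d : ℕ} (D : Concept) (P : Measure Ω)
    (X : Fin d → Ω → ℝ) : Prop :=
  match D with
  | .PA => DiversificationPenalty.PA P X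
  | .PRD => DiversificationPenalty.PRD P X
  | .WPA => DiversificationPenalty.WPA P X
  | .POD => DiversificationPenalty.POD P X
  | .NA => DiversificationPenalty.NA P X
  | .NRD => DiversificationPenalty.NRD P X
  | .WNA => DiversificationPenalty.WNA P X
  | .NOD => DiversificationPenalty.NOD P X
  | .IN => iIndepFun X P

/-- The stochastic order `F ≤_st G` of two distributions on the real line. -/
def StLE (F G : Measure ℝ) : Prop := ∀ x : ℝ, F (Set.Ioi x) ≤ G (Set.Ioi x)

/-- The class `F_D` of all distributions `F` on the real line such that
`X ≤_st ∑ θ_i X_i` for all `θ` in the standard simplex, whenever `X, X_1, …, X_d` have the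
distribution `F` and `(X_1, …, X_d)` satisfies `D`. -/
def diversificationClass (D : Concept) (d : ℕ) : Set (Measure ℝ) :=
  {F | IsProbabilityMeasure F ∧
    ∀ (Ω : Type) [MeasurableSpace Ω] (P : Measure Ω) [IsProbabilityMeasure P]
      (X : Fin d → Ω → ℝ), (∀ i, Measurable (X i)) → (∀ i, P.map (X i) = F) →
      D.Satisfies P X →
      ∀ θ ∈ stdSimplex ℝ (Fin d), StLE F (P.map (fun ω => ∑ i, θ i * X i ω))}

end DiversificationPenalty

/-! Let `Y_1, …, Y_d` have the law of `f(X)` and satisfy `D`. The plan is to construct, on a larger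
probability space, `X_1, …, X_d` with law `F` that still satisfy `D` and have `f(X_i) = Y_i` almost
surely. The hypothesis on `F` then applies to the `X_i`. The event that `f` exceeds `y` is, on `I`,
an upper set of the line, and Jensen's inequality gives `f(∑ θ_i X_i) ≤ ∑ θ_i Y_i`, so the
stochastic order passes to the `Y_i` (`stLE_map_of_convexOn`).

An increasing convex function is strictly increasing once it has left its minimum
(`lt_of_convexOn_of_lt`). Hence `Y_i` determines `X_i` except at the minimum value of `f`, where a
whole set of minimizers may be available. There `X_i` is set to `U_i`, drawn independently of `Y`
from `F` conditioned on the minimizers. This gives `X_i = h(Y_i, U_i)` with `h = randInverse`, and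
`map_randInverse` shows that the law is `F`.

The remaining point is that `X` inherits `D` (`Concept.Satisfies.exists_couple`). For a fixed value
of `U`, each `X_i` is an increasing function of `Y_i`, and every concept other than regression
dependence is checked to survive such transforms (lemmas `comp`). Mixing over `U` must then not
destroy it (lemmas `couple`). With independent `U_i`, products of marginal probabilities are
averages of conditional products, and conditional means over disjoint blocks are uncorrelated. For
positive association the blocks may overlap, and a common `U_1 = … = U_d` reduces the claim to
Chebyshev's inequality on the line. Regression dependence is treated directly: `X_i` determines `Y_i
= f(X_i)`, so a monotone regression function of `Y_i` becomes one of `X_i` by composition with `f`.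
-/

namespace DiversificationPenalty

open MeasureTheory ProbabilityTheory Filter Topology

/-! ### Monotone functions and lower sets on the line -/

section Order

/-- A function that is monotone on a Borel set is Borel measurable there. -/
lemma measurable_indicator_of_monotoneOn {S : Set ℝ} (hS : MeasurableSet S) {f : ℝ → ℝ}
    (hf : MonotoneOn f S) : Measurable (S.indicator f) := by
  have key : ∀ y, MeasurableSet (S ∩ f ⁻¹' Set.Iic y) := by
    intro y
    -- A sublevel set is the trace on `S` of a lower set, and lower sets of the line are intervals,
    -- hence Borel.
    have h : S ∩ f ⁻¹' Set.Iic y = S ∩ (lowerClosure (S ∩ f ⁻¹' Set.Iic y) : Set ℝ) := by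
      ext x
      constructor
      · exact fun hx => ⟨hx.1, subset_lowerClosure hx⟩
      · rintro ⟨hxS, z, hz, hxz⟩
        exact ⟨hxS, (hf hxS hz.1 hxz).trans hz.2⟩
    rw [h]
    exact hS.inter (lowerClosure _).lower.ordConnected.measurableSet
  refine measurable_of_Iic fun y => ?_
  rw [Set.indicator_preimage, Set.ite]
  exact (Set.inter_comm _ _ ▸ key y).union ((measurable_const measurableSet_Iic).diff hS)

/-- Every lower set of the real line is a pointwise limit of closed half-lines. -/
lemma exists_seq_Iic_of_isLowerSet {L : Set ℝ} (hL : IsLowerSet L) :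
    ∃ t : ℕ → ℝ, ∀ y, ∀ᶠ n in atTop, (y ≤ t n ↔ y ∈ L) := by
  rcases L.eq_empty_or_nonempty with rfl | hne
  · refine ⟨fun n => -n, fun y => ?_⟩
    filter_upwards [(tendsto_natCast_atTop_atTop (R := ℝ)).eventually_gt_atTop (-y)] with n hn
    simp only [Set.mem_empty_iff_false, iff_false, not_le]
    linarith
  by_cases hb : BddAbove L
  · by_cases hs : sSup L ∈ L
    · exact ⟨fun _ => sSup L, fun y => Eventually.of_forall fun _ =>
        ⟨fun h => hL h hs, fun h => le_csSup hb h⟩⟩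
    -- Here `L` is an open half-line, so the closed half-lines approach it from inside.
    · refine ⟨fun n => sSup L - 1 / ((n : ℝ) + 1), fun y => ?_⟩
      have hlim : Tendsto (fun n : ℕ => sSup L - 1 / ((n : ℝ) + 1)) atTop (𝓝 (sSup L)) := by
        simpa using tendsto_const_nhds.sub (tendsto_one_div_add_atTop_nhds_zero_nat (𝕜 := ℝ))
      by_cases hy : y < sSup L
      · obtain ⟨z, hz, hyz⟩ := exists_lt_of_lt_csSup hne hy
        filter_upwards [hlim.eventually (eventually_ge_nhds hy)] with n hn
        exact ⟨fun _ => hL hyz.le hz, fun _ => hn⟩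
      · refine Eventually.of_forall fun n => ⟨fun h => absurd h ?_, fun h => absurd ?_ hs⟩
        · have : (0 : ℝ) < 1 / ((n : ℝ) + 1) := by positivity
          push Not at hy ⊢
          linarith
        · rwa [le_antisymm (not_lt.1 hy) (le_csSup hb h)]
  · refine ⟨fun n => n, fun y => ?_⟩
    rw [not_bddAbove_iff] at hb
    obtain ⟨z, hz, hyz⟩ := hb y
    filter_upwards [(tendsto_natCast_atTop_atTop (R := ℝ)).eventually_ge_atTop y] with n hn
    exact ⟨fun _ => hL hyz.le hz, fun _ => hn⟩

end Order

/-! ### Stochastic order on arbitrary upper sets -/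

section Limits

variable {Ω : Type*} [MeasurableSpace Ω]

lemma tendsto_measure_of_eventually_iff (P : Measure Ω) [IsFiniteMeasure P] {A : ℕ → Set Ω}
    {B : Set Ω} (hA : ∀ n, MeasurableSet (A n)) (h : ∀ ω, ∀ᶠ n in atTop, (ω ∈ A n ↔ ω ∈ B)) :
    Tendsto (fun n => P (A n)) atTop (𝓝 (P B)) :=
  tendsto_measure_of_tendsto_indicator_of_isFiniteMeasure atTop P hA h

/-- The order is defined by open half-lines; a closed one is a limit of these. Closed ones do occur:
the points where `f` exceeds `y` can include the left end of `I`. -/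
lemma StLE.le_of_isUpperSet {F G : Measure ℝ} [IsFiniteMeasure F] [IsFiniteMeasure G]
    (h : StLE F G) {W : Set ℝ} (hW : IsUpperSet W) : F W ≤ G W := by
  obtain ⟨t, ht⟩ := exists_seq_Iic_of_isLowerSet hW.compl
  have ht' : ∀ y, ∀ᶠ n in atTop, (y ∈ Set.Ioi (t n) ↔ y ∈ W) := fun y => by
    filter_upwards [ht y] with n hn
    rw [Set.mem_Ioi, ← not_le, hn, Set.mem_compl_iff, not_not]
  exact le_of_tendsto_of_tendsto'
    (tendsto_measure_of_eventually_iff F (fun _ => measurableSet_Ioi) ht')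
    (tendsto_measure_of_eventually_iff G (fun _ => measurableSet_Ioi) ht') fun n => h (t n)

end Limits

/-! ### Bounded integrands, Chebyshev's inequality, independent blocks -/

section Integrals

lemma integrable_of_abs_le {α : Type*} [MeasurableSpace α] {μ : Measure α} [IsFiniteMeasure μ]
    {f : α → ℝ} (hf : Measurable f) {C : ℝ} (hC : ∀ x, |f x| ≤ C) : Integrable f μ :=
  Integrable.of_bound hf.aestronglyMeasurable C (ae_of_all _ hC)

lemma abs_integral_le_of_abs_le {α : Type*} [MeasurableSpace α] {μ : Measure α}
    [IsProbabilityMeasure μ] {f : α → ℝ} {C : ℝ} (hC : ∀ x, |f x| ≤ C) : |∫ x, f x ∂μ| ≤ C := by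
  simpa using norm_integral_le_of_norm_le_const (μ := μ) (f := f) (ae_of_all _ hC)

/-- Chebyshev's inequality for two increasing functions on the real line. -/
lemma integral_mul_integral_le_of_monotone {ρ : Measure ℝ} [IsProbabilityMeasure ρ] {a b : ℝ → ℝ}
    (ha : Monotone a) (hb : Monotone b) {C D : ℝ} (hC : ∀ x, |a x| ≤ C) (hD : ∀ x, |b x| ≤ D) :
    (∫ x, a x ∂ρ) * ∫ x, b x ∂ρ ≤ ∫ x, a x * b x ∂ρ := by
  have hab : Integrable (fun x => a x * b x) ρ :=
    integrable_of_abs_le (ha.measurable.mul hb.measurable) (C := C * D) fun x => by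
      rw [abs_mul]
      exact mul_le_mul (hC x) (hD x) (abs_nonneg _) ((abs_nonneg _).trans (hC x))
  have hai := integrable_of_abs_le (μ := ρ) ha.measurable hC
  have hbi := integrable_of_abs_le (μ := ρ) hb.measurable hD
  -- This is the integral over `y` of `(a x - a y) * (b x - b y)`, whose factors have the same sign.
  -- Integrating over `x` as well gives twice the covariance.
  have hinner : ∀ x, 0 ≤ a x * b x + ∫ y, a y * b y ∂ρ - a x * ∫ y, b y ∂ρ
      - b x * ∫ y, a y ∂ρ := by
    intro x
    have h : 0 ≤ ∫ y, (a x - a y) * (b x - b y) ∂ρ := by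
      refine integral_nonneg fun y => ?_
      rcases le_total x y with h | h
      · exact mul_nonneg_of_nonpos_of_nonpos (sub_nonpos.2 (ha h)) (sub_nonpos.2 (hb h))
      · exact mul_nonneg (sub_nonneg.2 (ha h)) (sub_nonneg.2 (hb h))
    have e : ∫ y, (a x - a y) * (b x - b y) ∂ρ
        = ∫ y, (a x * b x + a y * b y - a x * b y - b x * a y) ∂ρ := by
      congr 1; ext y; ring
    rw [e, integral_sub, integral_sub, integral_add, integral_const_mul, integral_const_mul,
      integral_const] at h
    · simpa [integral_const_mul] using h
    all_goals fun_prop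
  have := integral_nonneg (μ := ρ) (Pi.le_def.2 hinner)
  rw [integral_sub, integral_sub, integral_add, integral_mul_const, integral_mul_const,
    integral_const] at this
  · simp only [probReal_univ, smul_eq_mul, one_mul] at this
    linarith
  all_goals fun_prop

variable {d : ℕ}

/-- Under a product measure, the coordinates in disjoint index sets are independent. -/
lemma indepFun_pi_of_disjoint (ν : Measure ℝ) [IsProbabilityMeasure ν] {A B : Set (Fin d)}
    (hAB : Disjoint A B) :
    IndepFun (fun (u : Fin d → ℝ) (k : A) => u k) (fun (u : Fin d → ℝ) (k : B) => u k)
      (Measure.pi fun _ => ν) := by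
  classical
  have hi : iIndepFun (fun (i : Fin d) (u : Fin d → ℝ) => u i) (Measure.pi fun _ => ν) :=
    iIndepFun_pi (X := fun _ x => x) fun _ => aemeasurable_id
  have h := hi.indepFun_finset A.toFinset B.toFinset (Set.disjoint_toFinset.2 hAB)
    fun i => measurable_pi_apply i
  have hA : Measurable fun (v : A.toFinset → ℝ) (k : A) => v ⟨k, by simp⟩ := by fun_prop
  have hB : Measurable fun (v : B.toFinset → ℝ) (k : B) => v ⟨k, by simp⟩ := by fun_prop
  exact h.comp hA hB

end Integrals

/-! ### Truncation -/

section Truncation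

/-- Truncation at the levels `-n` and `n`. -/
noncomputable def trunc (n : ℕ) (x : ℝ) : ℝ := max (-n) (min n x)

lemma monotone_trunc (n : ℕ) : Monotone (trunc n) :=
  fun _ _ h => max_le_max le_rfl (min_le_min le_rfl h)

lemma measurable_trunc (n : ℕ) : Measurable (trunc n) := (monotone_trunc n).measurable

lemma abs_trunc_le (n : ℕ) (x : ℝ) : |trunc n x| ≤ n := by
  have hn : (0 : ℝ) ≤ n := n.cast_nonneg
  rw [abs_le, trunc]
  exact ⟨le_max_left _ _, max_le (by linarith) (min_le_left _ _)⟩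

lemma abs_trunc_le_abs (n : ℕ) (x : ℝ) : |trunc n x| ≤ |x| := by
  have hn : (0 : ℝ) ≤ n := n.cast_nonneg
  rw [abs_le, trunc]
  refine ⟨le_max_of_le_right (le_min ?_ (neg_abs_le x)), max_le ?_ ?_⟩
  · linarith [abs_nonneg x]
  · linarith [abs_nonneg x]
  · exact (min_le_right _ _).trans (le_abs_self x)

lemma eventually_trunc_eq (x : ℝ) : ∀ᶠ n in atTop, trunc n x = x := by
  filter_upwards [(tendsto_natCast_atTop_atTop (R := ℝ)).eventually_ge_atTop |x|] with n hn
  rw [trunc, min_eq_right ((le_abs_self x).trans hn),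
    max_eq_right (by linarith [neg_abs_le x])]

lemma tendsto_trunc (x : ℝ) : Tendsto (fun n => trunc n x) atTop (𝓝 x) :=
  tendsto_const_nhds.congr' ((eventually_trunc_eq x).mono fun _ h => h.symm)

end Truncation

/-! ### Reduction to bounded functions -/

section Reduction

variable {Ω : Type*} [MeasurableSpace Ω] {P : Measure Ω}

lemma CovExists.covariance_eq [IsProbabilityMeasure P] {U V : Ω → ℝ} (h : CovExists P U V) :
    covariance U V P = ∫ ω, U ω * V ω ∂P - (∫ ω, U ω ∂P) * ∫ ω, V ω ∂P := by
  obtain ⟨hU, hV, hUV⟩ := h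
  have e : ∀ ω, (U ω - ∫ ω, U ω ∂P) * (V ω - ∫ ω, V ω ∂P)
      = U ω * V ω - (∫ ω, U ω ∂P) * V ω - U ω * (∫ ω, V ω ∂P)
        + (∫ ω, U ω ∂P) * ∫ ω, V ω ∂P := fun ω => by ring
  rw [covariance]
  simp_rw [e]
  rw [integral_add, integral_sub, integral_sub, integral_const_mul, integral_mul_const,
    integral_const]
  · simp
  all_goals fun_prop

/-- Covariance inequalities for bounded increasing functions extend to all increasing, and to all
decreasing, functions whose covariance exists. -/
lemma covariance_sign_of_bounded [IsProbabilityMeasure P] {α β : Type*} (s : ℝ) {V : Ω → α → ℝ} {W : Ω → β → ℝ}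
    (hV : Measurable V) (hW : Measurable W)
    (H : ∀ (φ : (α → ℝ) → ℝ) (ψ : (β → ℝ) → ℝ) (C : ℝ), Measurable φ → Measurable ψ →
      Monotone φ → Monotone ψ → (∀ x, |φ x| ≤ C) → (∀ x, |ψ x| ≤ C) →
      0 ≤ s * (∫ ω, φ (V ω) * ψ (W ω) ∂P - (∫ ω, φ (V ω) ∂P) * ∫ ω, ψ (W ω) ∂P))
    {f : (α → ℝ) → ℝ} {g : (β → ℝ) → ℝ} (hf : Measurable f) (hg : Measurable g)
    (hfg : SameMonotonicity f g)
    (hcov : CovExists P (fun ω => f (V ω)) (fun ω => g (W ω))) :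
    0 ≤ s * covariance (fun ω => f (V ω)) (fun ω => g (W ω)) P := by
  have mono : ∀ {f : (α → ℝ) → ℝ} {g : (β → ℝ) → ℝ}, Measurable f → Measurable g →
      Monotone f → Monotone g → CovExists P (fun ω => f (V ω)) (fun ω => g (W ω)) →
      0 ≤ s * (∫ ω, f (V ω) * g (W ω) ∂P - (∫ ω, f (V ω) ∂P) * ∫ ω, g (W ω) ∂P) := by
    intro f g hf hg hfm hgm ⟨hfi, hgi, hfgi⟩
    have hfV : ∀ n, Measurable fun ω => trunc n (f (V ω)) :=
      fun n => (measurable_trunc n).comp (hf.comp hV)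
    have hgW : ∀ n, Measurable fun ω => trunc n (g (W ω)) :=
      fun n => (measurable_trunc n).comp (hg.comp hW)
    have l1 : Tendsto (fun n => ∫ ω, trunc n (f (V ω)) ∂P) atTop (𝓝 (∫ ω, f (V ω) ∂P)) :=
      tendsto_integral_of_dominated_convergence (fun ω => |f (V ω)|)
        (fun n => (hfV n).aestronglyMeasurable) hfi.abs
        (fun n => ae_of_all _ fun ω => abs_trunc_le_abs _ _)
        (ae_of_all _ fun ω => tendsto_trunc _)
    have l2 : Tendsto (fun n => ∫ ω, trunc n (g (W ω)) ∂P) atTop (𝓝 (∫ ω, g (W ω) ∂P)) :=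
      tendsto_integral_of_dominated_convergence (fun ω => |g (W ω)|)
        (fun n => (hgW n).aestronglyMeasurable) hgi.abs
        (fun n => ae_of_all _ fun ω => abs_trunc_le_abs _ _)
        (ae_of_all _ fun ω => tendsto_trunc _)
    have l3 : Tendsto (fun n => ∫ ω, trunc n (f (V ω)) * trunc n (g (W ω)) ∂P) atTop
        (𝓝 (∫ ω, f (V ω) * g (W ω) ∂P)) :=
      tendsto_integral_of_dominated_convergence (fun ω => |f (V ω) * g (W ω)|)
        (fun n => ((hfV n).mul (hgW n)).aestronglyMeasurable) hfgi.abs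
        (fun n => ae_of_all _ fun ω => by
          rw [Real.norm_eq_abs, abs_mul, abs_mul]
          exact mul_le_mul (abs_trunc_le_abs _ _) (abs_trunc_le_abs _ _) (abs_nonneg _)
            (abs_nonneg _))
        (ae_of_all _ fun ω => (tendsto_trunc _).mul (tendsto_trunc _))
    refine ge_of_tendsto' ((l3.sub (l1.mul l2)).const_mul s) fun n => ?_
    exact H (fun x => trunc n (f x)) (fun x => trunc n (g x)) n ((measurable_trunc n).comp hf)
      ((measurable_trunc n).comp hg) ((monotone_trunc n).comp hfm) ((monotone_trunc n).comp hgm)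
      (fun _ => abs_trunc_le _ _) fun _ => abs_trunc_le _ _
  rw [hcov.covariance_eq]
  rcases hfg with ⟨hfm, hgm⟩ | ⟨hfm, hgm⟩
  · exact mono hf hg hfm hgm hcov
  · have h := mono (f := fun x => -f x) (g := fun x => -g x) hf.neg hg.neg hfm.neg hgm.neg
      ⟨hcov.1.neg, hcov.2.1.neg, by simpa using hcov.2.2⟩
    simpa [integral_neg] using h

/-- A monotone regression function can be chosen Borel measurable. -/
lemma exists_measurable_monotoneOn {Z V : Ω → ℝ} {S : Set ℝ} {φ : ℝ → ℝ} {s : ℝ}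
    (hS : MeasurableSet S) (hZS : ∀ᵐ ω ∂P, Z ω ∈ S) (hφ : MonotoneOn φ S)
    (hV : ∀ᵐ ω ∂P, V ω = s * φ (Z ω)) :
    ∃ ψ : ℝ → ℝ, Measurable ψ ∧ MonotoneOn ψ S ∧ ∀ᵐ ω ∂P, V ω = s * ψ (Z ω) := by
  refine ⟨S.indicator φ, measurable_indicator_of_monotoneOn hS hφ, fun x hx y hy h => ?_, ?_⟩
  · simpa [hx, hy] using hφ hx hy h
  · filter_upwards [hZS, hV] with ω h1 h2
    simpa [h1] using h2

/-- Monotonicity of the regression function passes from the truncations of an integrable random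
variable to the random variable itself. -/
lemma exists_monotone_regression_of_trunc [IsProbabilityMeasure P] {Z V : Ω → ℝ}
    (hV : Measurable V) (hVi : Integrable V P) {s : ℝ} (hs : s ≠ 0)
    (H : ∀ n, ∃ (S : Set ℝ) (φ : ℝ → ℝ), MeasurableSet S ∧ (∀ᵐ ω ∂P, Z ω ∈ S) ∧
      MonotoneOn φ S ∧
      ∀ᵐ ω ∂P, condExp (MeasurableSpace.comap Z inferInstance) P (fun ω => trunc n (V ω)) ω
        = s * φ (Z ω)) :
    ∃ (S : Set ℝ) (φ : ℝ → ℝ), MeasurableSet S ∧ (∀ᵐ ω ∂P, Z ω ∈ S) ∧ MonotoneOn φ S ∧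
      ∀ᵐ ω ∂P, condExp (MeasurableSpace.comap Z inferInstance) P V ω = s * φ (Z ω) := by
  have hVn : ∀ n, Measurable fun ω => trunc n (V ω) := fun n => (measurable_trunc n).comp hV
  have hVni : ∀ n, Integrable (fun ω => trunc n (V ω)) P := fun n =>
    integrable_of_abs_le (hVn n) fun _ => abs_trunc_le _ _
  -- Conditional expectation contracts the `L¹` norm, so the conditional expectations of the
  -- truncations converge in `L¹`, and almost surely along a subsequence.
  have hlim : Tendsto (fun n => eLpNorm (P[fun ω => trunc n (V ω) | MeasurableSpace.comap Z inferInstance]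
      - P[V | MeasurableSpace.comap Z inferInstance]) 1 P) atTop (𝓝 0) := by
    have h0 : Tendsto (fun n => ∫⁻ ω, ‖trunc n (V ω) - V ω‖ₑ ∂P) atTop (𝓝 0) := by
      have h := tendsto_lintegral_norm_of_dominated_convergence (μ := P)
        (F := fun n ω => trunc n (V ω)) (f := V) (bound := fun ω => |V ω|)
        (fun n => (hVn n).aestronglyMeasurable) hVi.abs.2
        (fun n => ae_of_all _ fun ω => abs_trunc_le_abs _ _)
        (ae_of_all _ fun ω => tendsto_trunc _)
      simpa only [ofReal_norm] using h
    refine tendsto_of_tendsto_of_tendsto_of_le_of_le tendsto_const_nhds h0 (fun _ => zero_le)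
      fun n => ?_
    rw [← eLpNorm_congr_ae (condExp_sub (hVni n) hVi _)]
    refine (eLpNorm_condExp_le_eLpNorm _ le_rfl).trans ?_
    rw [eLpNorm_one_eq_lintegral_enorm]
    rfl
  obtain ⟨ns, -, hns⟩ := (tendstoInMeasure_of_tendsto_eLpNorm one_ne_zero
    (fun n => integrable_condExp.1) integrable_condExp.1 hlim).exists_seq_tendsto_ae
  choose S φ hS hZS hφ hV' using H
  -- Borel versions are needed so that the convergence set `T` below is Borel; on it the pointwise
  -- limit of increasing functions is increasing.
  choose ψ hψm hψ hVψ using fun n => exists_measurable_monotoneOn (hS n) (hZS n) (hφ n) (hV' n)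
  let L : ℝ → ℝ := fun x => limUnder atTop fun k => ψ (ns k) x
  let T : Set ℝ := {x | ∃ l, Tendsto (fun k => ψ (ns k) x) atTop (𝓝 l)}
  have hT : MeasurableSet T := measurableSet_exists_tendsto fun k => hψm (ns k)
  have hL : ∀ x ∈ T, Tendsto (fun k => ψ (ns k) x) atTop (𝓝 (L x)) :=
    fun x hx => tendsto_nhds_limUnder hx
  have hconv : ∀ᵐ ω ∂P, Tendsto (fun k => ψ (ns k) (Z ω)) atTop 
      (𝓝 (s⁻¹ * P[V | MeasurableSpace.comap Z inferInstance] ω)) := by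
    filter_upwards [hns, ae_all_iff.2 hVψ] with ω h1 h2
    have h3 := h1.const_mul s⁻¹
    simp_rw [h2] at h3
    simpa [hs] using h3
  refine ⟨(⋂ n, S n) ∩ T, L, (MeasurableSet.iInter hS).inter hT, ?_, ?_, ?_⟩
  · filter_upwards [hconv, ae_all_iff.2 hZS] with ω h1 h2
    exact ⟨Set.mem_iInter.2 h2, _, h1⟩
  · intro x hx y hy hxy
    exact le_of_tendsto_of_tendsto' (hL x hx.2) (hL y hy.2) fun k =>
      hψ _ (Set.mem_iInter.1 hx.1 _) (Set.mem_iInter.1 hy.1 _) hxy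
  · filter_upwards [hconv] with ω h1
    rw [← tendsto_nhds_unique h1 (hL _ ⟨_, h1⟩)]
    field_simp

end Reduction

/-! ### Increasing transforms: orthant dependence -/

section Composition

variable {Ω : Type*} [MeasurableSpace Ω] {d : ℕ} {P : Measure Ω}

lemma measurable_sub {X : Fin d → Ω → ℝ} (hX : ∀ i, Measurable (X i)) (A : Set (Fin d)) :
    Measurable (sub X A) :=
  measurable_pi_lambda _ fun k => hX k

lemma measurable_drop {X : Fin d → Ω → ℝ} (hX : ∀ i, Measurable (X i)) (i : Fin d) :
    Measurable (drop X i) :=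
  measurable_pi_lambda _ fun k => hX k

open Classical in
/-- The function `φ ∘ f` on `T ^ ι`, extended by the constant `-C`. -/
noncomputable def extend {ι : Type*} (T : Set ℝ) (f : ι → ℝ → ℝ) (φ : (ι → ℝ) → ℝ) (C : ℝ)
    (y : ι → ℝ) : ℝ :=
  if ∀ k, y k ∈ T then φ (fun k => f k (y k)) else -C

section extend

variable {ι : Type*} {T : Set ℝ} {f : ι → ℝ → ℝ} {φ : (ι → ℝ) → ℝ} {C : ℝ}

lemma extend_of_mem {y : ι → ℝ} (hy : ∀ k, y k ∈ T) :
    extend T f φ C y = φ (fun k => f k (y k)) := if_pos hy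

lemma abs_extend_le (hC : ∀ x, |φ x| ≤ C) (y : ι → ℝ) : |extend T f φ C y| ≤ C := by
  unfold extend
  split_ifs
  · exact hC _
  · rw [abs_neg, abs_of_nonneg ((abs_nonneg _).trans (hC 0))]

/-- The complement of `T ^ ι` is a lower set, and `-C` is a lower bound of `φ`, so the constant sits
below everything it has to. -/
lemma monotone_extend (hT : IsUpperSet T) (hf : ∀ k, MonotoneOn (f k) T) (hφ : Monotone φ)
    (hC : ∀ x, |φ x| ≤ C) : Monotone (extend T f φ C) := by
  intro y z hyz
  by_cases hy : ∀ k, y k ∈ T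
  · have hz : ∀ k, z k ∈ T := fun k => hT (hyz k) (hy k)
    rw [extend_of_mem hy, extend_of_mem hz]
    exact hφ fun k => hf k (hy k) (hz k) (hyz k)
  · rw [extend, if_neg hy]
    exact (abs_le.1 (abs_extend_le hC z)).1

lemma measurable_extend [Countable ι] (hT : IsUpperSet T) (hf : ∀ k, Measurable (f k))
    (hφ : Measurable φ) : Measurable (extend T f φ C) := by
  refine Measurable.ite ?_ (hφ.comp (by fun_prop)) measurable_const
  have := hT.ordConnected.measurableSet
  measurability

end extend

lemma measure_eq_of_ae_iff {A B : Ω → Prop} (h : ∀ᵐ ω ∂P, (A ω ↔ B ω)) :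
    P {ω | A ω} = P {ω | B ω} :=
  measure_congr (h.mono fun _ hω => propext hω)

/-- The lower set of the points of the line that `f` maps below `x`, up to points outside `T`. -/
def lowerPreimage (T : Set ℝ) (f : ℝ → ℝ) (x : ℝ) : Set ℝ := {y | y ∈ T → f y ≤ x}

/-- All points outside `T` are included, and they lie below `T`; monotonicity of `f` is only
available on `T`. -/
lemma isLowerSet_lowerPreimage {T : Set ℝ} (hT : IsUpperSet T) {f : ℝ → ℝ} (hf : MonotoneOn f T)
    (x : ℝ) : IsLowerSet (lowerPreimage T f x) :=
  fun _ _ hyz hz hy => (hf hy (hT hyz hy) hyz).trans (hz (hT hyz hy))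

/-- The orthant probabilities of a random vector at lower sets are limits of those at half-lines. -/
lemma exists_seq_tendsto_orthant [IsProbabilityMeasure P] {Y : Fin d → Ω → ℝ}
    (hY : ∀ i, Measurable (Y i)) {L : Fin d → Set ℝ} (hL : ∀ i, IsLowerSet (L i)) :
    ∃ t : ℕ → Fin d → ℝ,
      Tendsto (fun n => P {ω | ∀ i, Y i ω ≤ t n i}) atTop (𝓝 (P {ω | ∀ i, Y i ω ∈ L i})) ∧
      Tendsto (fun n => P {ω | ∀ i, t n i < Y i ω}) atTop (𝓝 (P {ω | ∀ i, Y i ω ∉ L i})) ∧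
      Tendsto (fun n => ∏ i, P {ω | Y i ω ≤ t n i}) atTop (𝓝 (∏ i, P {ω | Y i ω ∈ L i})) ∧
      Tendsto (fun n => ∏ i, P {ω | t n i < Y i ω}) atTop (𝓝 (∏ i, P {ω | Y i ω ∉ L i})) := by
  choose t ht using fun i => exists_seq_Iic_of_isLowerSet (hL i)
  have ht' : ∀ i y, ∀ᶠ n in atTop, (t i n < y ↔ y ∉ L i) := fun i y => by
    filter_upwards [ht i y] with n hn
    rw [← not_le, hn]
  refine ⟨fun n i => t i n, ?_, ?_, ?_, ?_⟩
  · refine tendsto_measure_of_eventually_iff P (fun n => ?_) fun ω => ?_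
    · exact measurableSet_setOfPred.2 (.forall fun i => measurableSet_setOfPred.1
        (measurableSet_le (hY i) measurable_const))
    · filter_upwards [eventually_all.2 fun i => ht i (Y i ω)] with n hn
      exact forall_congr' hn
  · refine tendsto_measure_of_eventually_iff P (fun n => ?_) fun ω => ?_
    · exact measurableSet_setOfPred.2 (.forall fun i => measurableSet_setOfPred.1
        (measurableSet_lt measurable_const (hY i)))
    · filter_upwards [eventually_all.2 fun i => ht' i (Y i ω)] with n hn
      exact forall_congr' hn
  · refine ENNReal.tendsto_finsetProd_of_ne_top _ (fun i _ => ?_) fun i _ => measure_ne_top _ _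
    exact tendsto_measure_of_eventually_iff P (fun n => measurableSet_le (hY i) measurable_const)
      fun ω => ht i (Y i ω)
  · refine ENNReal.tendsto_finsetProd_of_ne_top _ (fun i _ => ?_) fun i _ => measure_ne_top _ _
    exact tendsto_measure_of_eventually_iff P (fun n => measurableSet_lt measurable_const (hY i))
      fun ω => ht' i (Y i ω)

variable {Y : Fin d → Ω → ℝ} {T : Set ℝ} {f : Fin d → ℝ → ℝ}

lemma orthant_comp_eq (hYT : ∀ i, ∀ᵐ ω ∂P, Y i ω ∈ T) (x : Fin d → ℝ) :
    P {ω | ∀ i, f i (Y i ω) ≤ x i} = P {ω | ∀ i, Y i ω ∈ lowerPreimage T (f i) (x i)} ∧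
    P {ω | ∀ i, x i < f i (Y i ω)} = P {ω | ∀ i, Y i ω ∉ lowerPreimage T (f i) (x i)} ∧
    (∀ i, P {ω | f i (Y i ω) ≤ x i} = P {ω | Y i ω ∈ lowerPreimage T (f i) (x i)}) ∧
    ∀ i, P {ω | x i < f i (Y i ω)} = P {ω | Y i ω ∉ lowerPreimage T (f i) (x i)} := by
  have h : ∀ i ω, Y i ω ∈ T → (f i (Y i ω) ≤ x i ↔ Y i ω ∈ lowerPreimage T (f i) (x i)) :=
    fun i ω hω => ⟨fun h _ => h, fun h => h hω⟩
  have h' : ∀ i ω, Y i ω ∈ T → (x i < f i (Y i ω) ↔ Y i ω ∉ lowerPreimage T (f i) (x i)) :=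
    fun i ω hω => by rw [← h i ω hω, not_le]
  refine ⟨measure_eq_of_ae_iff ?_, measure_eq_of_ae_iff ?_, fun i => measure_eq_of_ae_iff ?_,
    fun i => measure_eq_of_ae_iff ?_⟩
  · filter_upwards [ae_all_iff.2 hYT] with ω hω using forall_congr' fun i => h i ω (hω i)
  · filter_upwards [ae_all_iff.2 hYT] with ω hω using forall_congr' fun i => h' i ω (hω i)
  · filter_upwards [hYT i] with ω hω using h i ω hω
  · filter_upwards [hYT i] with ω hω using h' i ω hω

variable [IsProbabilityMeasure P] (hY : ∀ i, Measurable (Y i)) (hT : IsUpperSet T)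
  (hYT : ∀ i, ∀ᵐ ω ∂P, Y i ω ∈ T) (hf : ∀ i, MonotoneOn (f i) T)
include hY hT hYT hf

/-- Up to null sets, `f i (Y i) ≤ x i` says that `Y i` lies in a lower set. That set may be an open
half-line, so the orthant inequalities are passed to the limit. -/
lemma POD.comp (h : POD P Y) : POD P fun i ω => f i (Y i ω) := by
  intro x
  obtain ⟨e1, e2, e3, e4⟩ := orthant_comp_eq (f := f) hYT x
  simp_rw [e1, e2, e3, e4]
  obtain ⟨t, h1, h2, h3, h4⟩ := exists_seq_tendsto_orthant (P := P) hY
    fun i => isLowerSet_lowerPreimage hT (hf i) (x i)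
  exact ⟨le_of_tendsto_of_tendsto' h3 h1 fun n => (h (t n)).1,
    le_of_tendsto_of_tendsto' h4 h2 fun n => (h (t n)).2⟩

lemma NOD.comp (h : NOD P Y) : NOD P fun i ω => f i (Y i ω) := by
  intro x
  obtain ⟨e1, e2, e3, e4⟩ := orthant_comp_eq (f := f) hYT x
  simp_rw [e1, e2, e3, e4]
  obtain ⟨t, h1, h2, h3, h4⟩ := exists_seq_tendsto_orthant (P := P) hY
    fun i => isLowerSet_lowerPreimage hT (hf i) (x i)
  exact ⟨le_of_tendsto_of_tendsto' h1 h3 fun n => (h (t n)).1,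
    le_of_tendsto_of_tendsto' h2 h4 fun n => (h (t n)).2⟩

end Composition

/-! ### Increasing transforms: weak association -/

section WeakAssociation

variable {Ω : Type*} [MeasurableSpace Ω] {d : ℕ} {P : Measure Ω}

/-- The product form is trivial when the conditioning event is null, and, unlike the conditional
form, can be integrated over `U` and passed to limits. -/
lemma wpa_iff [IsProbabilityMeasure P] {Y : Fin d → Ω → ℝ} (hY : ∀ i, Measurable (Y i)) :
    WPA P Y ↔ ∀ (i : Fin d) (S : Set ({k : Fin d // k ≠ i} → ℝ)), MeasurableSet S →
      IsLowerSet S → ∀ x : ℝ,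
      P {ω | Y i ω ≤ x} * P {ω | drop Y i ω ∈ S} ≤ P {ω | Y i ω ≤ x ∧ drop Y i ω ∈ S} := by
  refine forall_congr' fun i => forall_congr' fun S => forall_congr' fun hS =>
    forall_congr' fun hSl => forall_congr' fun x => ?_
  rw [cond_apply (measurableSet_le (hY i) measurable_const)]
  rcases eq_or_ne (P {ω | Y i ω ≤ x}) 0 with h0 | h0
  · simp [h0]
  · rw [← ENNReal.mul_le_iff_le_inv h0 (measure_ne_top _ _)]
    exact ⟨fun h => h (pos_iff_ne_zero.2 h0), fun h _ => h⟩

lemma wna_iff [IsProbabilityMeasure P] {Y : Fin d → Ω → ℝ} (hY : ∀ i, Measurable (Y i)) :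
    WNA P Y ↔ ∀ (i : Fin d) (S : Set ({k : Fin d // k ≠ i} → ℝ)), MeasurableSet S →
      IsLowerSet S → ∀ x : ℝ,
      P {ω | Y i ω ≤ x ∧ drop Y i ω ∈ S} ≤ P {ω | Y i ω ≤ x} * P {ω | drop Y i ω ∈ S} := by
  refine forall_congr' fun i => forall_congr' fun S => forall_congr' fun hS =>
    forall_congr' fun hSl => forall_congr' fun x => ?_
  rw [cond_apply (measurableSet_le (hY i) measurable_const)]
  rcases eq_or_ne (P {ω | Y i ω ≤ x}) 0 with h0 | h0
  · have h : P {ω | Y i ω ≤ x ∧ drop Y i ω ∈ S} = 0 :=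
      measure_mono_null (fun ω hω => hω.1) h0
    simp [h0, h]
  · rw [ENNReal.inv_mul_le_iff h0 (measure_ne_top _ _)]
    exact ⟨fun h => h (pos_iff_ne_zero.2 h0), fun h _ => h⟩

/-- Lower sets are pulled back to lower sets, up to points outside `T`. -/
def lowerPreimagePi {ι : Type*} (T : Set ℝ) (f : ι → ℝ → ℝ) (S : Set (ι → ℝ)) : Set (ι → ℝ) :=
  {y | (∀ k, y k ∈ T) → (fun k => f k (y k)) ∈ S}

lemma isLowerSet_lowerPreimagePi {ι : Type*} {T : Set ℝ} (hT : IsUpperSet T) {f : ι → ℝ → ℝ}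
    (hf : ∀ k, MonotoneOn (f k) T) {S : Set (ι → ℝ)} (hS : IsLowerSet S) :
    IsLowerSet (lowerPreimagePi T f S) := by
  intro y z hyz hy hz
  have hyT : ∀ k, y k ∈ T := fun k => hT (hyz k) (hz k)
  exact hS (fun k => hf k (hz k) (hyT k) (hyz k)) (hy hyT)

lemma measurableSet_lowerPreimagePi {ι : Type*} [Countable ι] {T : Set ℝ} (hT : IsUpperSet T)
    {f : ι → ℝ → ℝ} (hf : ∀ k, Measurable (f k)) {S : Set (ι → ℝ)} (hS : MeasurableSet S) :
    MeasurableSet (lowerPreimagePi T f S) := by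
  have hT' := hT.ordConnected.measurableSet
  have h1 : MeasurableSet {y : ι → ℝ | ∀ k, y k ∈ T} := by measurability
  have h2 : MeasurableSet {y : ι → ℝ | (fun k => f k (y k)) ∈ S} :=
    (show Measurable fun y : ι → ℝ => fun k => f k (y k) by fun_prop) hS
  exact h1.imp h2

variable {Y : Fin d → Ω → ℝ} {T : Set ℝ} {f : Fin d → ℝ → ℝ}

lemma half_line_comp_eq (hYT : ∀ i, ∀ᵐ ω ∂P, Y i ω ∈ T) (i : Fin d)
    (S : Set ({k : Fin d // k ≠ i} → ℝ)) (x : ℝ) :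
    P {ω | f i (Y i ω) ≤ x} = P {ω | Y i ω ∈ lowerPreimage T (f i) x} ∧
    P {ω | drop (fun i ω => f i (Y i ω)) i ω ∈ S} =
      P {ω | drop Y i ω ∈ lowerPreimagePi T (fun k : {k // k ≠ i} => f k) S} ∧
    P {ω | f i (Y i ω) ≤ x ∧ drop (fun i ω => f i (Y i ω)) i ω ∈ S} =
      P {ω | Y i ω ∈ lowerPreimage T (f i) x ∧
        drop Y i ω ∈ lowerPreimagePi T (fun k : {k // k ≠ i} => f k) S} := by
  have h : ∀ ω, (∀ i, Y i ω ∈ T) → (f i (Y i ω) ≤ x ↔ Y i ω ∈ lowerPreimage T (f i) x) :=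
    fun ω hω => ⟨fun h _ => h, fun h => h (hω i)⟩
  have h' : ∀ ω, (∀ i, Y i ω ∈ T) → (drop (fun i ω => f i (Y i ω)) i ω ∈ S ↔
      drop Y i ω ∈ lowerPreimagePi T (fun k : {k // k ≠ i} => f k) S) :=
    fun ω hω => ⟨fun h _ => h, fun h => h fun k => hω k⟩
  refine ⟨measure_eq_of_ae_iff ?_, measure_eq_of_ae_iff ?_, measure_eq_of_ae_iff ?_⟩
  · filter_upwards [ae_all_iff.2 hYT] with ω hω using h ω hω
  · filter_upwards [ae_all_iff.2 hYT] with ω hω using h' ω hω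
  · filter_upwards [ae_all_iff.2 hYT] with ω hω using and_congr (h ω hω) (h' ω hω)

lemma exists_seq_tendsto_half_line [IsProbabilityMeasure P] (hY : ∀ i, Measurable (Y i))
    (i : Fin d) {L : Set ℝ} (hL : IsLowerSet L) {S : Set ({k : Fin d // k ≠ i} → ℝ)} (hS : MeasurableSet S) :
    ∃ t : ℕ → ℝ,
      Tendsto (fun n => P {ω | Y i ω ≤ t n} * P {ω | drop Y i ω ∈ S}) atTop
        (𝓝 (P {ω | Y i ω ∈ L} * P {ω | drop Y i ω ∈ S})) ∧
      Tendsto (fun n => P {ω | Y i ω ≤ t n ∧ drop Y i ω ∈ S}) atTop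
        (𝓝 (P {ω | Y i ω ∈ L ∧ drop Y i ω ∈ S})) := by
  obtain ⟨t, ht⟩ := exists_seq_Iic_of_isLowerSet hL
  have hm : ∀ n, MeasurableSet {ω | Y i ω ≤ t n} :=
    fun n => measurableSet_le (hY i) measurable_const
  refine ⟨t, ENNReal.Tendsto.mul_const ?_ (.inr (measure_ne_top _ _)), ?_⟩
  · exact tendsto_measure_of_eventually_iff P hm fun ω => ht (Y i ω)
  · refine tendsto_measure_of_eventually_iff P
      (fun n => (hm n).inter (measurable_drop hY i hS)) fun ω => ?_
    filter_upwards [ht (Y i ω)] with n hn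
    exact and_congr hn Iff.rfl

variable [IsProbabilityMeasure P] (hY : ∀ i, Measurable (Y i)) (hT : IsUpperSet T)
  (hYT : ∀ i, ∀ᵐ ω ∂P, Y i ω ∈ T) (hf : ∀ i, MonotoneOn (f i) T) (hfm : ∀ i, Measurable (f i))
include hY hT hYT hf hfm

lemma WPA.comp (h : WPA P Y) : WPA P fun i ω => f i (Y i ω) := by
  rw [wpa_iff hY] at h
  refine (wpa_iff fun i => (hfm i).comp (hY i)).2 ?_
  intro i S hS hSl x
  simp_rw [Function.comp_def]
  obtain ⟨e1, e2, e3⟩ := half_line_comp_eq (f := f) hYT i S x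
  rw [e1, e2, e3]
  have hS' := measurableSet_lowerPreimagePi hT (f := fun k : {k // k ≠ i} => f k)
    (fun k => hfm k) hS
  obtain ⟨t, h1, h2⟩ := exists_seq_tendsto_half_line (P := P) hY i
    (isLowerSet_lowerPreimage hT (hf i) x) hS'
  exact le_of_tendsto_of_tendsto' h1 h2 fun n =>
    h i _ hS' (isLowerSet_lowerPreimagePi hT (fun k : {k // k ≠ i} => hf k) hSl) (t n)

lemma WNA.comp (h : WNA P Y) : WNA P fun i ω => f i (Y i ω) := by
  rw [wna_iff hY] at h
  refine (wna_iff fun i => (hfm i).comp (hY i)).2 ?_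
  intro i S hS hSl x
  simp_rw [Function.comp_def]
  obtain ⟨e1, e2, e3⟩ := half_line_comp_eq (f := f) hYT i S x
  rw [e1, e2, e3]
  have hS' := measurableSet_lowerPreimagePi hT (f := fun k : {k // k ≠ i} => f k)
    (fun k => hfm k) hS
  obtain ⟨t, h1, h2⟩ := exists_seq_tendsto_half_line (P := P) hY i
    (isLowerSet_lowerPreimage hT (hf i) x) hS'
  exact le_of_tendsto_of_tendsto' h2 h1 fun n =>
    h i _ hS' (isLowerSet_lowerPreimagePi hT (fun k : {k // k ≠ i} => hf k) hSl) (t n)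

end WeakAssociation

/-! ### Increasing transforms: association -/

section Association

variable {Ω : Type*} [MeasurableSpace Ω] {d : ℕ} {P : Measure Ω} [IsProbabilityMeasure P]
  {Y : Fin d → Ω → ℝ} {T : Set ℝ} {f : Fin d → ℝ → ℝ}

lemma covExists_of_bounded {U V : Ω → ℝ} (hU : Measurable U) (hV : Measurable V) {C : ℝ}
    (hUC : ∀ ω, |U ω| ≤ C) (hVC : ∀ ω, |V ω| ≤ C) : CovExists P U V :=
  ⟨integrable_of_abs_le hU hUC, integrable_of_abs_le hV hVC,
    integrable_of_abs_le (hU.mul hV) (C := C * C) fun ω => by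
      rw [abs_mul]
      exact mul_le_mul (hUC ω) (hVC ω) (abs_nonneg _) ((abs_nonneg _).trans (hUC ω))⟩

variable (hY : ∀ i, Measurable (Y i)) (hT : IsUpperSet T) (hYT : ∀ i, ∀ᵐ ω ∂P, Y i ω ∈ T)
  (hf : ∀ i, MonotoneOn (f i) T) (hfm : ∀ i, Measurable (f i))
include hY hT hYT hf hfm

/-- A covariance inequality for the bounded increasing functions of `Y_A` and `Y_B` carries over to
coordinatewise increasing transforms of `Y`. -/
lemma covariance_sign_comp (s : ℝ) (A B : Set (Fin d))
    (h : ∀ (φ : (A → ℝ) → ℝ) (ψ : (B → ℝ) → ℝ), Measurable φ → Measurable ψ →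
      SameMonotonicity φ ψ → CovExists P (fun ω => φ (sub Y A ω)) (fun ω => ψ (sub Y B ω)) →
      0 ≤ s * covariance (fun ω => φ (sub Y A ω)) (fun ω => ψ (sub Y B ω)) P)
    {φ : (A → ℝ) → ℝ} {ψ : (B → ℝ) → ℝ} (hφ : Measurable φ) (hψ : Measurable ψ)
    (hφψ : SameMonotonicity φ ψ)
    (hcov : CovExists P (fun ω => φ (sub (fun i ω => f i (Y i ω)) A ω))
      (fun ω => ψ (sub (fun i ω => f i (Y i ω)) B ω))) :
    0 ≤ s * covariance (fun ω => φ (sub (fun i ω => f i (Y i ω)) A ω))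
      (fun ω => ψ (sub (fun i ω => f i (Y i ω)) B ω)) P := by
  have hX : ∀ i, Measurable fun ω => f i (Y i ω) := fun i => (hfm i).comp (hY i)
  -- Boundedness is what allows extension from `T` to an increasing function on the whole space,
  -- with a lower bound as the value outside. The sign `s` treats positive and negative association
  -- together.
  refine covariance_sign_of_bounded s (measurable_sub hX A) (measurable_sub hX B) ?_ hφ hψ hφψ
    hcov
  intro φ ψ C hφ hψ hφm hψm hφC hψC
  have e : ∀ (A : Set (Fin d)) (φ : (A → ℝ) → ℝ),
      (fun ω => φ (sub (fun i ω => f i (Y i ω)) A ω))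
        =ᵐ[P] fun ω => extend T (fun k : A => f k) φ C (sub Y A ω) := fun A φ => by
    filter_upwards [ae_all_iff.2 hYT] with ω hω
    exact (extend_of_mem (y := sub Y A ω) fun k => hω k).symm
  have m1 := measurable_extend (f := fun k : A => f k) (C := C) hT (fun k => hfm k) hφ
  have m2 := measurable_extend (f := fun k : B => f k) (C := C) hT (fun k => hfm k) hψ
  have hce : CovExists P (fun ω => extend T (fun k : A => f k) φ C (sub Y A ω))
      (fun ω => extend T (fun k : B => f k) ψ C (sub Y B ω)) := covExists_of_bounded (m1.comp (measurable_sub hY A))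
    (m2.comp (measurable_sub hY B)) (fun ω => abs_extend_le hφC _) fun ω => abs_extend_le hψC _
  have key := h _ _ m1 m2 (.inl ⟨monotone_extend hT (fun k => hf k) hφm hφC,
    monotone_extend hT (fun k => hf k) hψm hψC⟩) hce
  rw [CovExists.covariance_eq hce] at key
  rw [integral_congr_ae (e A φ), integral_congr_ae (e B ψ),
    integral_congr_ae (show (fun ω => _ * _) =ᵐ[P] _ from (e A φ).mul (e B ψ))]
  exact key

lemma PA.comp (h : PA P Y) : PA P fun i ω => f i (Y i ω) := by
  intro A B φ ψ hφ hψ hφψ hcov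
  simpa using covariance_sign_comp hY hT hYT hf hfm 1 A B
    (fun φ ψ h1 h2 h3 h4 => by simpa using h A B φ ψ h1 h2 h3 h4) hφ hψ hφψ hcov

lemma NA.comp (h : NA P Y) : NA P fun i ω => f i (Y i ω) := by
  intro A B hAB φ ψ hφ hψ hφψ hcov
  simpa using covariance_sign_comp hY hT hYT hf hfm (-1) A B
    (fun φ ψ h1 h2 h3 h4 => by simpa using h A B hAB φ ψ h1 h2 h3 h4) hφ hψ hφψ hcov

end Association

/-! ### Mixing over the randomization: orthant dependence and independence -/

section Coupling

variable {Ω : Type*} [MeasurableSpace Ω] {d : ℕ} {P : Measure Ω} [IsProbabilityMeasure P]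
  {E : Type*} [MeasurableSpace E] {ρ : Measure E} [IsProbabilityMeasure ρ]

/-- The random vector with coordinates `h (Y_i, U_i)`, where `Y` and `U` live on the two factors of
a product space. -/
def couple (h : ℝ → ℝ → ℝ) (Y : Fin d → Ω → ℝ) (U : Fin d → E → ℝ) (i : Fin d) (p : Ω × E) : ℝ :=
  h (Y i p.1) (U i p.2)

variable {h : ℝ → ℝ → ℝ} {Y : Fin d → Ω → ℝ} {U : Fin d → E → ℝ}

lemma measurable_couple (hh : Measurable (Function.uncurry h)) (hY : ∀ i, Measurable (Y i))
    (hU : ∀ i, Measurable (U i)) (i : Fin d) : Measurable (couple h Y U i) :=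
  hh.comp (((hY i).comp measurable_fst).prodMk ((hU i).comp measurable_snd))

section Product

variable {ν : Measure ℝ} [IsProbabilityMeasure ν] (hh : Measurable (Function.uncurry h))
  (hY : ∀ i, Measurable (Y i))
include hh hY

lemma measurable_measure_section (i : Fin d) {B : Set ℝ} (hB : MeasurableSet B) :
    Measurable fun v => P {ω | h (Y i ω) v ∈ B} := by
  have hm : MeasurableSet {p : Ω × ℝ | h (Y i p.1) p.2 ∈ B} :=
    (hh.comp (((hY i).comp measurable_fst).prodMk measurable_snd)) hB
  exact measurable_measure_prodMk_right hm

/-- Given `u`, the `i`-th marginal probability depends on `u i` alone, and the `u i` are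
independent, so the product of averages is the average of the product. Orthant inequalities valid
for each `u` can therefore simply be integrated. -/
lemma prod_measure_couple_eq_lintegral {B : Fin d → Set ℝ} (hB : ∀ i, MeasurableSet (B i)) :
    ∏ i, (P.prod (Measure.pi fun _ => ν)) {p | couple h Y (fun i (u : Fin d → ℝ) => u i) i p ∈ B i}
      = ∫⁻ u, ∏ i, P {ω | h (Y i ω) (u i) ∈ B i} ∂(Measure.pi fun _ => ν) := by
  have hm := fun i => measurable_measure_section (P := P) hh hY i (hB i)
  have hind : iIndepFun (fun (i : Fin d) (u : Fin d → ℝ) => P {ω | h (Y i ω) (u i) ∈ B i})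
      (Measure.pi fun _ => ν) :=
    iIndepFun_pi (X := fun i v => P {ω | h (Y i ω) v ∈ B i}) fun i => (hm i).aemeasurable
  rw [lintegral_prod_eq_prod_lintegral_of_indepFun _ _ hind
    fun i => (hm i).comp (measurable_pi_apply i)]
  refine Finset.prod_congr rfl fun i _ => ?_
  exact Measure.prod_apply_symm
    (measurable_couple hh hY (fun i => measurable_pi_apply i) i (hB i))

lemma measure_couple_eq_lintegral {B : Fin d → Set ℝ} (hB : ∀ i, MeasurableSet (B i)) :
    (P.prod (Measure.pi fun _ => ν))
        {p | ∀ i, couple h Y (fun i (u : Fin d → ℝ) => u i) i p ∈ B i}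
      = ∫⁻ u, P {ω | ∀ i, h (Y i ω) (u i) ∈ B i} ∂(Measure.pi fun _ => ν) := by
  have hm : MeasurableSet {p | ∀ i, couple h Y (fun i (u : Fin d → ℝ) => u i) i p ∈ B i} := by
    rw [Set.ofPred_forall]
    exact MeasurableSet.iInter fun i =>
      measurable_couple hh hY (fun i => measurable_pi_apply i) i (hB i)
  rw [Measure.prod_apply_symm hm]
  rfl

lemma POD.couple (H : ∀ u : Fin d → ℝ, POD P fun i ω => h (Y i ω) (u i)) :
    POD (P.prod (Measure.pi fun _ => ν)) (couple h Y fun i (u : Fin d → ℝ) => u i) := by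
  intro x
  have e1 := prod_measure_couple_eq_lintegral (P := P) (ν := ν) hh hY
    (B := fun i => Set.Iic (x i)) fun i => measurableSet_Iic
  have e2 := measure_couple_eq_lintegral (P := P) (ν := ν) hh hY
    (B := fun i => Set.Iic (x i)) fun i => measurableSet_Iic
  have e3 := prod_measure_couple_eq_lintegral (P := P) (ν := ν) hh hY
    (B := fun i => Set.Ioi (x i)) fun i => measurableSet_Ioi
  have e4 := measure_couple_eq_lintegral (P := P) (ν := ν) hh hY
    (B := fun i => Set.Ioi (x i)) fun i => measurableSet_Ioi
  simp only [Set.mem_Iic, Set.mem_Ioi] at e1 e2 e3 e4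
  rw [e1, e2, e3, e4]
  exact ⟨lintegral_mono fun u => (H u x).1, lintegral_mono fun u => (H u x).2⟩

lemma NOD.couple (H : ∀ u : Fin d → ℝ, NOD P fun i ω => h (Y i ω) (u i)) :
    NOD (P.prod (Measure.pi fun _ => ν)) (couple h Y fun i (u : Fin d → ℝ) => u i) := by
  intro x
  have e1 := prod_measure_couple_eq_lintegral (P := P) (ν := ν) hh hY
    (B := fun i => Set.Iic (x i)) fun i => measurableSet_Iic
  have e2 := measure_couple_eq_lintegral (P := P) (ν := ν) hh hY
    (B := fun i => Set.Iic (x i)) fun i => measurableSet_Iic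
  have e3 := prod_measure_couple_eq_lintegral (P := P) (ν := ν) hh hY
    (B := fun i => Set.Ioi (x i)) fun i => measurableSet_Ioi
  have e4 := measure_couple_eq_lintegral (P := P) (ν := ν) hh hY
    (B := fun i => Set.Ioi (x i)) fun i => measurableSet_Ioi
  simp only [Set.mem_Iic, Set.mem_Ioi] at e1 e2 e3 e4
  rw [e1, e2, e3, e4]
  exact ⟨lintegral_mono fun u => (H u x).1, lintegral_mono fun u => (H u x).2⟩

lemma iIndepFun_couple (H : iIndepFun Y P) :
    iIndepFun (couple h Y fun i (u : Fin d → ℝ) => u i) (P.prod (Measure.pi fun _ => ν)) := by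
  classical
  rw [iIndepFun_iff_measure_inter_preimage_eq_mul]
  intro S B hB
  -- Padding with the trivial event turns a subfamily into the full family of coordinates.
  let B' : Fin d → Set ℝ := fun i => if i ∈ S then B i else Set.univ
  have hB' : ∀ i, MeasurableSet (B' i) := fun i => by
    by_cases hi : i ∈ S
    · simpa [B', hi] using hB i hi
    · simp [B', hi]
  have e1 : (⋂ i ∈ S, couple h Y (fun i (u : Fin d → ℝ) => u i) i ⁻¹' B i)
      = {p | ∀ i, couple h Y (fun i (u : Fin d → ℝ) => u i) i p ∈ B' i} := by
    ext p
    simp only [Set.mem_iInter, Set.mem_preimage, Set.mem_ofPred_eq]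
    refine forall_congr' fun i => ?_
    by_cases hi : i ∈ S <;> simp [B', hi]
  have e2 : ∏ i ∈ S, (P.prod (Measure.pi fun _ => ν))
        (couple h Y (fun i (u : Fin d → ℝ) => u i) i ⁻¹' B i)
      = ∏ i, (P.prod (Measure.pi fun _ => ν))
        {p | couple h Y (fun i (u : Fin d → ℝ) => u i) i p ∈ B' i} := by
    rw [← Finset.prod_subset (Finset.subset_univ S)]
    · refine Finset.prod_congr rfl fun i hi => ?_
      simp only [B', hi, if_true]
      rfl
    · intro i _ hi
      simp [B', hi]
  rw [e1, e2, prod_measure_couple_eq_lintegral hh hY hB', measure_couple_eq_lintegral hh hY hB']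
  refine lintegral_congr fun u => ?_
  have hu : iIndepFun (fun i ω => h (Y i ω) (u i)) P :=
    H.comp (fun i y => h y (u i)) fun i => hh.comp (measurable_id.prodMk measurable_const)
  have := hu.measure_inter_preimage_eq_mul Finset.univ (sets := B') fun i _ => hB' i
  refine Eq.trans (congrArg P ?_) this
  ext ω
  simp

end Product

end Coupling

/-! ### Mixing over the randomization: weak association and association -/

section Coupling

variable {Ω : Type*} [MeasurableSpace Ω] {d : ℕ} {P : Measure Ω} [IsProbabilityMeasure P]
  {h : ℝ → ℝ → ℝ} {Y : Fin d → Ω → ℝ}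

/-- A coordinate and the vector of the other coordinates are independent under a product
measure. -/
lemma indepFun_eval_drop (ν : Measure ℝ) [IsProbabilityMeasure ν] (i : Fin d) :
    IndepFun (fun u : Fin d → ℝ => u i) (fun (u : Fin d → ℝ) (k : {k : Fin d // k ≠ i}) => u k)
      (Measure.pi fun _ => ν) := by
  have hm : Measurable fun v : ({i} : Set (Fin d)) → ℝ => v ⟨i, rfl⟩ := measurable_pi_apply _
  exact (indepFun_pi_of_disjoint ν (A := {i}) (B := {k | k ≠ i}) (by simp)).comp hm measurable_id

section Product

variable {ν : Measure ℝ} [IsProbabilityMeasure ν] (hh : Measurable (Function.uncurry h))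
  (hY : ∀ i, Measurable (Y i))
include hh hY

/-- The first factor depends on `u i` and the second on the other coordinates of `u`, so
independence merges the two averages into one. -/
lemma half_line_couple_eq_lintegral (i : Fin d) {S : Set ({k : Fin d // k ≠ i} → ℝ)}
    (hS : MeasurableSet S) (x : ℝ) :
    (P.prod (Measure.pi fun _ => ν)) {p | couple h Y (fun i (u : Fin d → ℝ) => u i) i p ≤ x} *
      (P.prod (Measure.pi fun _ => ν))
        {p | drop (couple h Y fun i (u : Fin d → ℝ) => u i) i p ∈ S}
      = ∫⁻ u, P {ω | h (Y i ω) (u i) ≤ x} * P {ω | drop (fun i ω => h (Y i ω) (u i)) i ω ∈ S}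
        ∂(Measure.pi fun _ => ν) ∧
    (P.prod (Measure.pi fun _ => ν)) {p | couple h Y (fun i (u : Fin d → ℝ) => u i) i p ≤ x ∧
        drop (couple h Y fun i (u : Fin d → ℝ) => u i) i p ∈ S}
      = ∫⁻ u, P {ω | h (Y i ω) (u i) ≤ x ∧ drop (fun i ω => h (Y i ω) (u i)) i ω ∈ S}
        ∂(Measure.pi fun _ => ν) := by
  have hX := measurable_couple (U := fun i (u : Fin d → ℝ) => u i) hh hY
    fun i => measurable_pi_apply i
  have m1 := measurableSet_le (hX i) (measurable_const (a := x))
  have m2 := measurable_drop hX i hS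
  have a1 := measurable_measure_section (P := P) hh hY i (measurableSet_Iic (a := x))
  have a2 : Measurable fun v : {k : Fin d // k ≠ i} → ℝ =>
      P {ω | (fun k : {k : Fin d // k ≠ i} => h (Y k ω) (v k)) ∈ S} := by
    have hm : Measurable fun (p : Ω × ({k : Fin d // k ≠ i} → ℝ)) (k : {k : Fin d // k ≠ i}) =>
        h (Y k p.1) (p.2 k) :=
      measurable_pi_lambda _ fun k => hh.comp
        (((hY k).comp measurable_fst).prodMk ((measurable_pi_apply k).comp measurable_snd))
    exact measurable_measure_prodMk_right (hm hS)
  have hind := (indepFun_eval_drop ν i).comp a1 a2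
  constructor
  · have := lintegral_mul_eq_lintegral_mul_lintegral_of_indepFun''
      (a1.comp (measurable_pi_apply i)).aemeasurable
      (a2.comp (measurable_pi_lambda _ fun k => measurable_pi_apply _)).aemeasurable hind
    rw [Measure.prod_apply_symm m1]
    refine Eq.trans ?_ this.symm
    congr 1
    exact Measure.prod_apply_symm m2
  · exact Measure.prod_apply_symm (m1.inter m2)

lemma WPA.couple (H : ∀ u : Fin d → ℝ, WPA P fun i ω => h (Y i ω) (u i)) :
    WPA (P.prod (Measure.pi fun _ => ν)) (couple h Y fun i (u : Fin d → ℝ) => u i) := by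
  refine (wpa_iff (measurable_couple hh hY fun i => measurable_pi_apply i)).2 ?_
  intro i S hS hSl x
  obtain ⟨e1, e2⟩ := half_line_couple_eq_lintegral (P := P) (ν := ν) hh hY i hS x
  rw [e1, e2]
  refine lintegral_mono fun u => ?_
  exact (wpa_iff fun i => (hh.comp (measurable_id.prodMk measurable_const)).comp (hY i)).1 (H u)
    i S hS hSl x

lemma WNA.couple (H : ∀ u : Fin d → ℝ, WNA P fun i ω => h (Y i ω) (u i)) :
    WNA (P.prod (Measure.pi fun _ => ν)) (couple h Y fun i (u : Fin d → ℝ) => u i) := by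
  refine (wna_iff (measurable_couple hh hY fun i => measurable_pi_apply i)).2 ?_
  intro i S hS hSl x
  obtain ⟨e1, e2⟩ := half_line_couple_eq_lintegral (P := P) (ν := ν) hh hY i hS x
  rw [e1, e2]
  refine lintegral_mono fun u => ?_
  exact (wna_iff fun i => (hh.comp (measurable_id.prodMk measurable_const)).comp (hY i)).1 (H u)
    i S hS hSl x

end Product

lemma measurable_couple_section {E : Type*} {U : Fin d → E → ℝ}
    (hh : Measurable (Function.uncurry h))
    (hY : ∀ i, Measurable (Y i)) (e : E) (i : Fin d) :
    Measurable fun ω => h (Y i ω) (U i e) :=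
  hh.comp ((hY i).prodMk measurable_const)

section Association

variable {E : Type*} [MeasurableSpace E] {ρ : Measure E} [IsProbabilityMeasure ρ]
  {U : Fin d → E → ℝ}

/-- A covariance inequality that holds conditionally on the second factor, and for the conditional
means, holds on the product space. -/
lemma covariance_sign_couple (hh : Measurable (Function.uncurry h)) (hY : ∀ i, Measurable (Y i))
    (hU : ∀ i, Measurable (U i)) (s : ℝ) (A B : Set (Fin d))
    (H : ∀ (e : E) (φ : (A → ℝ) → ℝ) (ψ : (B → ℝ) → ℝ), Measurable φ → Measurable ψ →
      SameMonotonicity φ ψ →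
      CovExists P (fun ω => φ (sub (fun i ω => h (Y i ω) (U i e)) A ω))
        (fun ω => ψ (sub (fun i ω => h (Y i ω) (U i e)) B ω)) →
      0 ≤ s * covariance (fun ω => φ (sub (fun i ω => h (Y i ω) (U i e)) A ω))
        (fun ω => ψ (sub (fun i ω => h (Y i ω) (U i e)) B ω)) P)
    (H' : ∀ (φ : (A → ℝ) → ℝ) (ψ : (B → ℝ) → ℝ) (C : ℝ), Measurable φ → Measurable ψ →
      Monotone φ → Monotone ψ → (∀ x, |φ x| ≤ C) → (∀ x, |ψ x| ≤ C) →
      0 ≤ s * (∫ e, (∫ ω, φ (sub (fun i ω => h (Y i ω) (U i e)) A ω) ∂P) *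
          (∫ ω, ψ (sub (fun i ω => h (Y i ω) (U i e)) B ω) ∂P) ∂ρ -
        (∫ e, ∫ ω, φ (sub (fun i ω => h (Y i ω) (U i e)) A ω) ∂P ∂ρ) *
          ∫ e, ∫ ω, ψ (sub (fun i ω => h (Y i ω) (U i e)) B ω) ∂P ∂ρ))
    {f : (A → ℝ) → ℝ} {g : (B → ℝ) → ℝ} (hf : Measurable f) (hg : Measurable g)
    (hfg : SameMonotonicity f g)
    (hcov : CovExists (P.prod ρ) (fun p => f (sub (couple h Y U) A p))
      (fun p => g (sub (couple h Y U) B p))) :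
    0 ≤ s * covariance (fun p => f (sub (couple h Y U) A p))
      (fun p => g (sub (couple h Y U) B p)) (P.prod ρ) := by
  have hX := measurable_couple hh hY hU
  refine covariance_sign_of_bounded s (measurable_sub hX A) (measurable_sub hX B) ?_ hf hg hfg
    hcov
  intro φ ψ C hφ hψ hφm hψm hφC hψC
  obtain ⟨i1, i2, i3⟩ := covExists_of_bounded (P := P.prod ρ) (hφ.comp (measurable_sub hX A))
    (hψ.comp (measurable_sub hX B)) (fun _ => hφC _) (fun _ => hψC _)
  have key := H' φ ψ C hφ hψ hφm hψm hφC hψC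
  have s1 := integral_prod_symm _ i1
  have s2 := integral_prod_symm _ i2
  have s3 := integral_prod_symm _ i3
  simp only [Function.comp_apply] at s1 s2 s3
  rw [s1, s2, s3]
  -- Law of total covariance: `key` gives the sign for the covariance of the conditional means, and
  -- what is left is the mean of the conditional covariances, which `H` controls for each `e`.
  refine key.trans ?_
  rw [mul_sub, mul_sub]
  refine sub_le_sub_right ?_ _
  rw [← integral_const_mul, ← integral_const_mul]
  have hm1 := i1.integral_prod_right
  have hm2 := i2.integral_prod_right
  refine integral_mono ?_ (i3.integral_prod_right.const_mul s) fun e => ?_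
  · refine Integrable.const_mul ?_ s
    refine hm2.bdd_mul (c := C) hm1.1 (ae_of_all _ fun e => ?_)
    exact abs_integral_le_of_abs_le fun ω => hφC _
  · have hXe := measurable_couple_section (U := U) hh hY e
    have hce : CovExists P (fun ω => φ (sub (fun i ω => h (Y i ω) (U i e)) A ω))
        (fun ω => ψ (sub (fun i ω => h (Y i ω) (U i e)) B ω)) :=
      covExists_of_bounded (hφ.comp (measurable_sub hXe A)) (hψ.comp (measurable_sub hXe B))
        (fun _ => hφC _) (fun _ => hψC _)
    have h1 := H e φ ψ hφ hψ (.inl ⟨hφm, hψm⟩) hce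
    rw [hce.covariance_eq, mul_sub, sub_nonneg] at h1
    exact h1

/-- Since `A` and `B` may overlap, the conditional means need not be independent. With one common
`u` they are increasing functions of a real variable, and Chebyshev's inequality applies; this is
where monotonicity of `h` in `u` enters. -/
lemma PA.couple {T : Set ℝ} {ν : Measure ℝ} [IsProbabilityMeasure ν]
    (hh : Measurable (Function.uncurry h)) (hY : ∀ i, Measurable (Y i))
    (hYT : ∀ i, ∀ᵐ ω ∂P, Y i ω ∈ T) (hmono : ∀ y ∈ T, Monotone (h y))
    (H : ∀ u : ℝ, PA P fun i ω => h (Y i ω) u) :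
    PA (P.prod ν) (couple h Y fun _ (u : ℝ) => u) := by
  intro A B f g hf hg hfg hcov
  have mono : ∀ (A : Set (Fin d)) (φ : (A → ℝ) → ℝ) (C : ℝ), Measurable φ → Monotone φ →
      (∀ x, |φ x| ≤ C) →
      Monotone fun u : ℝ => ∫ ω, φ (sub (fun i ω => h (Y i ω) u) A ω) ∂P := by
    intro A φ C hφ hφm hφC u v huv
    have hi : ∀ u : ℝ, Integrable (fun ω => φ (sub (fun i ω => h (Y i ω) u) A ω)) P := fun u =>
      integrable_of_abs_le (hφ.comp (measurable_sub
        (measurable_couple_section (U := fun _ (u : ℝ) => u) hh hY u) A)) fun _ => hφC _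
    refine integral_mono_ae (hi u) (hi v) ?_
    filter_upwards [ae_all_iff.2 hYT] with ω hω
    exact hφm fun k => hmono _ (hω k) huv
  simpa using covariance_sign_couple (ρ := ν) (U := fun _ (u : ℝ) => u) hh hY
    (fun _ => measurable_id) 1 A B
    (fun u φ ψ h1 h2 h3 h4 => by simpa using H u A B φ ψ h1 h2 h3 h4)
    (fun φ ψ C hφ hψ hφm hψm hφC hψC => by
      rw [one_mul, sub_nonneg]
      exact integral_mul_integral_le_of_monotone (mono A φ C hφ hφm hφC) (mono B ψ C hψ hψm hψC)
        (fun u => abs_integral_le_of_abs_le fun ω => hφC _)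
        (fun u => abs_integral_le_of_abs_le fun ω => hψC _)) hf hg hfg hcov

/-- For disjoint `A` and `B` the conditional means depend on disjoint blocks of independent
coordinates, so their covariance vanishes. -/
lemma NA.couple {ν : Measure ℝ} [IsProbabilityMeasure ν]
    (hh : Measurable (Function.uncurry h)) (hY : ∀ i, Measurable (Y i))
    (H : ∀ u : Fin d → ℝ, NA P fun i ω => h (Y i ω) (u i)) :
    NA (P.prod (Measure.pi fun _ => ν)) (couple h Y fun i (u : Fin d → ℝ) => u i) := by
  intro A B hAB f g hf hg hfg hcov
  have meas : ∀ (A : Set (Fin d)) (φ : (A → ℝ) → ℝ), Measurable φ →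
      Measurable fun v : A → ℝ => ∫ ω, φ (fun k => h (Y k ω) (v k)) ∂P := by
    intro A φ hφ
    have hm : Measurable fun p : (A → ℝ) × Ω => φ (fun k => h (Y k p.2) (p.1 k)) :=
      hφ.comp (measurable_pi_lambda _ fun k => hh.comp
        (((hY k).comp measurable_snd).prodMk ((measurable_pi_apply k).comp measurable_fst)))
    exact hm.stronglyMeasurable.integral_prod_right.measurable
  simpa using covariance_sign_couple (ρ := Measure.pi fun _ => ν)
    (U := fun i (u : Fin d → ℝ) => u i) hh hY (fun i => measurable_pi_apply i) (-1) A B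
    (fun u φ ψ h1 h2 h3 h4 => by simpa using H u A B hAB φ ψ h1 h2 h3 h4)
    (fun φ ψ C hφ hψ hφm hψm hφC hψC => by
      have hA : Measurable fun (u : Fin d → ℝ) (k : A) => u k := by fun_prop
      have hB : Measurable fun (u : Fin d → ℝ) (k : B) => u k := by fun_prop
      have e := ((indepFun_pi_of_disjoint ν hAB).comp (meas A φ hφ)
        (meas B ψ hψ)).integral_fun_mul_eq_mul_integral
        ((meas A φ hφ).comp hA).aestronglyMeasurable
        ((meas B ψ hψ).comp hB).aestronglyMeasurable
      exact (mul_eq_zero_of_right _ (sub_eq_zero.2 e)).ge) hf hg hfg hcov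

end Association

end Coupling

/-! ### Regression dependence -/

section Regression

variable {Ω : Type*} [MeasurableSpace Ω] {d : ℕ} {P : Measure Ω}

/-- Regression dependence of sign `s`: it is `PRD` for `s = 1` and `NRD` for `s = -1`. -/
def RegressionDependent (s : ℝ) (P : Measure Ω) (X : Fin d → Ω → ℝ) : Prop :=
  ∀ (i : Fin d) (g : ({k : Fin d // k ≠ i} → ℝ) → ℝ), Measurable g → Monotone g →
    Integrable (fun ω => g (drop X i ω)) P →
    ∃ (S : Set ℝ) (φ : ℝ → ℝ), MeasurableSet S ∧ (∀ᵐ ω ∂P, X i ω ∈ S) ∧ MonotoneOn φ S ∧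
      ∀ᵐ ω ∂P, condExpDrop P X i g ω = s * φ (X i ω)

lemma regressionDependent_one_iff {X : Fin d → Ω → ℝ} : RegressionDependent 1 P X ↔ PRD P X := by
  simp [RegressionDependent, PRD]

lemma regressionDependent_neg_one_iff {X : Fin d → Ω → ℝ} :
    RegressionDependent (-1) P X ↔ NRD P X := by
  refine forall_congr' fun i => forall_congr' fun g => forall_congr' fun _ =>
    forall_congr' fun _ => forall_congr' fun _ => exists_congr fun S => ?_
  constructor
  · rintro ⟨φ, h1, h2, h3, h4⟩
    exact ⟨fun x => -φ x, h1, h2, h3.neg, by simpa using h4⟩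
  · rintro ⟨φ, h1, h2, h3, h4⟩
    exact ⟨fun x => -φ x, h1, h2, h3.neg, by simpa using h4⟩

/-- A bounded function of `Z` can be integrated against `V` or against `E[V | Z]`. -/
lemma integral_mul_condExp_comp [IsProbabilityMeasure P] {Z V : Ω → ℝ} (hZ : Measurable Z)
    (hV : Integrable V P) {b : ℝ → ℝ} (hb : Measurable b) {C : ℝ} (hC : ∀ x, |b x| ≤ C) :
    ∫ ω, b (Z ω) * V ω ∂P
      = ∫ ω, b (Z ω) * condExp (MeasurableSpace.comap Z inferInstance) P V ω ∂P := by
  have hbV : Integrable (fun ω => b (Z ω) * V ω) P :=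
    hV.bdd_mul (c := C) (hb.comp hZ).aestronglyMeasurable (ae_of_all _ fun ω => hC _)
  rw [← integral_condExp (f := fun ω => b (Z ω) * V ω) hZ.comap_le]
  refine integral_congr_ae ?_
  exact condExp_mul_of_stronglyMeasurable_left
    (hb.comp (comap_measurable Z)).stronglyMeasurable hbV hV

variable [IsProbabilityMeasure P] {h : ℝ → ℝ → ℝ} {Y : Fin d → Ω → ℝ} {T : Set ℝ}
  {ν : Measure ℝ} [IsProbabilityMeasure ν]

/-- Averaging a function of `h (Y_k, U_k)`, `k ≠ i`, over the independent `U_k`, at a point where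
it is multiplied by a function of `h (Y_i, U_i)`. -/
lemma integral_section_mul (hh : Measurable (Function.uncurry h)) (i : Fin d) {χ : ℝ → ℝ}
    (hχ : Measurable χ) {g : ({k : Fin d // k ≠ i} → ℝ) → ℝ} (hg : Measurable g) (y : Fin d → ℝ) :
    ∫ u : Fin d → ℝ, χ (h (y i) (u i)) * g (fun k => h (y k) (u k)) ∂(Measure.pi fun _ => ν)
      = (∫ u : Fin d → ℝ, χ (h (y i) (u i)) ∂(Measure.pi fun _ => ν)) *
        ∫ u : Fin d → ℝ, g (fun k => h (y k) (u k)) ∂(Measure.pi fun _ => ν) := by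
  have hsec : ∀ y, Measurable (h y) := fun y => hh.comp (measurable_const.prodMk measurable_id)
  have m1 : Measurable fun v => χ (h (y i) v) := hχ.comp (hsec _)
  have m2 : Measurable fun v : {k : Fin d // k ≠ i} → ℝ => g (fun k => h (y k) (v k)) :=
    hg.comp (measurable_pi_lambda _ fun k => (hsec _).comp (measurable_pi_apply k))
  have hd : Measurable fun (u : Fin d → ℝ) (k : {k : Fin d // k ≠ i}) => u k := by fun_prop
  exact ((indepFun_eval_drop ν i).comp m1 m2).integral_fun_mul_eq_mul_integral
    (m1.comp (measurable_pi_apply i)).aestronglyMeasurable (m2.comp hd).aestronglyMeasurable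

variable (hh : Measurable (Function.uncurry h)) (hY : ∀ i, Measurable (Y i)) (hT : IsUpperSet T)
  (hYT : ∀ i, ∀ᵐ ω ∂P, Y i ω ∈ T) (hmono : ∀ u, MonotoneOn (fun y => h y u) T)
include hh hY

/-- If `Y_i` is a function of `h (Y_i, U_i)`, then the regression function of the coupled vector is
obtained from a regression function of `Y`. -/
lemma condExp_couple_eq {r : ℝ → ℝ} (hr : Measurable r) (i : Fin d)
    (hrX : ∀ᵐ p ∂(P.prod (Measure.pi fun _ => ν)),
      r (couple h Y (fun i (u : Fin d → ℝ) => u i) i p) = Y i p.1)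
    {g : ({k : Fin d // k ≠ i} → ℝ) → ℝ} (hg : Measurable g) {C : ℝ} (hC : ∀ x, |g x| ≤ C)
    {c : ℝ → ℝ} (hc : Measurable c)
    (hcY : condExp (MeasurableSpace.comap (Y i) inferInstance) P
      (fun ω => ∫ u : Fin d → ℝ, g (fun k => h (Y k ω) (u k)) ∂(Measure.pi fun _ => ν))
      =ᵐ[P] fun ω => c (Y i ω)) :
    condExpDrop (P.prod (Measure.pi fun _ => ν)) (couple h Y fun i (u : Fin d → ℝ) => u i) i g
      =ᵐ[P.prod (Measure.pi fun _ => ν)]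
      fun p => c (r (couple h Y (fun i (u : Fin d → ℝ) => u i) i p)) := by
  set ρ : Measure (Fin d → ℝ) := Measure.pi fun _ => ν
  set X := couple h Y fun i (u : Fin d → ℝ) => u i with hXdef
  have hX : ∀ i, Measurable (X i) := measurable_couple hh hY fun i => measurable_pi_apply i
  have hgX : Measurable fun p => g (drop X i p) := hg.comp (measurable_drop hX i)
  have hgi : Integrable (fun p => g (drop X i p)) (P.prod ρ) :=
    integrable_of_abs_le hgX fun _ => hC _
  have hci : Integrable (fun ω => c (Y i ω)) P := integrable_condExp.congr hcY
  have hci' : Integrable (fun p : Ω × (Fin d → ℝ) => c (Y i p.1)) (P.prod ρ) := hci.comp_fst ρ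
  have hcr : (fun p => c (r (X i p))) =ᵐ[P.prod ρ] fun p => c (Y i p.1) := by
    filter_upwards [hrX] with p hp using by rw [hp]
  have hcri : Integrable (fun p => c (r (X i p))) (P.prod ρ) := hci'.congr hcr.symm
  refine (ae_eq_condExp_of_forall_setIntegral_eq (hX i).comap_le hgi
    (fun _ _ _ => hcri.integrableOn) ?_
    ((hc.comp hr).comp (comap_measurable (X i))).stronglyMeasurable.aestronglyMeasurable).symm
  rintro _ ⟨B, hB, rfl⟩ -
  let χ : ℝ → ℝ := B.indicator 1
  have hχ : Measurable χ := measurable_one.indicator hB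
  have hχC : ∀ x, |χ x| ≤ 1 := fun x => by
    by_cases hx : x ∈ B <;> simp [χ, hx]
  have hset : ∀ V : Ω × (Fin d → ℝ) → ℝ,
      ∫ p in X i ⁻¹' B, V p ∂(P.prod ρ) = ∫ p, χ (X i p) * V p ∂(P.prod ρ) := fun V => by
    rw [← integral_indicator (hX i hB)]
    refine integral_congr_ae (ae_of_all _ fun p => ?_)
    by_cases hp : X i p ∈ B <;> simp [χ, Set.indicator, hp]
  have hint : ∀ V : Ω × (Fin d → ℝ) → ℝ, Integrable V (P.prod ρ) →
      Integrable (fun p => χ (X i p) * V p) (P.prod ρ) := fun V hV =>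
    hV.bdd_mul (c := 1) (hχ.comp (hX i)).aestronglyMeasurable (ae_of_all _ fun p => hχC _)
  -- Given `Y`, the test function of `X i` and the function of the other coordinates can be averaged
  -- over `u` separately; `b (Y i)` is the average of the former.
  let b : ℝ → ℝ := fun y => ∫ u : Fin d → ℝ, χ (h y (u i)) ∂ρ
  have hb : Measurable b := by
    have hm : Measurable fun p : ℝ × (Fin d → ℝ) => χ (h p.1 (p.2 i)) :=
      hχ.comp (hh.comp (measurable_fst.prodMk ((measurable_pi_apply i).comp measurable_snd)))
    exact hm.stronglyMeasurable.integral_prod_right.measurable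
  have hbC : ∀ y, |b y| ≤ 1 := fun y => abs_integral_le_of_abs_le fun u => hχC _
  let G : Ω → ℝ := fun ω => ∫ u : Fin d → ℝ, g (fun k => h (Y k ω) (u k)) ∂ρ
  have hGi : Integrable G P := hgi.integral_prod_left
  rw [hset, hset]
  calc ∫ p, χ (X i p) * c (r (X i p)) ∂(P.prod ρ)
      = ∫ p, χ (X i p) * c (Y i p.1) ∂(P.prod ρ) := by
        refine integral_congr_ae ?_
        filter_upwards [hcr] with p hp using by rw [hp]
    _ = ∫ ω, b (Y i ω) * c (Y i ω) ∂P := by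
        rw [integral_prod _ (hint _ hci')]
        refine integral_congr_ae (ae_of_all _ fun ω => ?_)
        exact integral_mul_const (μ := ρ) (c (Y i ω)) fun u : Fin d → ℝ => χ (h (Y i ω) (u i))
    _ = ∫ ω, b (Y i ω) * condExp (MeasurableSpace.comap (Y i) inferInstance) P G ω ∂P := by
        refine integral_congr_ae ?_
        filter_upwards [hcY] with ω hω using by rw [← hω]
    _ = ∫ ω, b (Y i ω) * G ω ∂P := (integral_mul_condExp_comp (hY i) hGi hb hbC).symm
    _ = ∫ p, χ (X i p) * g (drop X i p) ∂(P.prod ρ) := by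
        rw [integral_prod _ (hint _ hgi)]
        refine integral_congr_ae (ae_of_all _ fun ω => ?_)
        exact (integral_section_mul hh i hχ hg fun k => Y k ω).symm

include hT hYT hmono

/-- Averaging out `u` turns a bounded increasing function of the other `X k` into an increasing
function of the other `Y k`. Its regression function on `Y i`, composed with the increasing map `r`
that recovers `Y i` from `X i`, is the one sought. -/
lemma RegressionDependent.couple {s : ℝ} (hs : s ≠ 0) {r : ℝ → ℝ} (hr : Measurable r) {S₀ : Set ℝ}
    (hS₀ : MeasurableSet S₀) (hrS₀ : MonotoneOn r S₀)
    (hrX : ∀ i, ∀ᵐ p ∂(P.prod (Measure.pi fun _ => ν)),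
      couple h Y (fun i (u : Fin d → ℝ) => u i) i p ∈ S₀ ∧
      r (couple h Y (fun i (u : Fin d → ℝ) => u i) i p) = Y i p.1)
    (H : RegressionDependent s P Y) :
    RegressionDependent s (P.prod (Measure.pi fun _ => ν))
      (couple h Y fun i (u : Fin d → ℝ) => u i) := by
  intro i g hg hgm hgi
  have hX := measurable_couple (U := fun i (u : Fin d → ℝ) => u i) hh hY
    fun i => measurable_pi_apply i
  refine exists_monotone_regression_of_trunc (hg.comp (measurable_drop hX i)) hgi hs fun n => ?_
  let φ : ({k : Fin d // k ≠ i} → ℝ) → ℝ := fun x => trunc n (g x)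
  have hφ : Measurable φ := (measurable_trunc n).comp hg
  have hφm : Monotone φ := (monotone_trunc n).comp hgm
  have hφC : ∀ x, |φ x| ≤ n := fun _ => abs_trunc_le _ _
  have hsec : ∀ v, Measurable fun y => h y v := fun v =>
    hh.comp (measurable_id.prodMk measurable_const)
  -- Extending before averaging makes `avg` increasing on the whole space, as the hypothesis on `Y`
  -- requires.
  let ext : (Fin d → ℝ) → ({k : Fin d // k ≠ i} → ℝ) → ℝ := fun u =>
    extend T (fun k y => h y (u k)) φ n
  have hext : Measurable fun p : ({k : Fin d // k ≠ i} → ℝ) × (Fin d → ℝ) => ext p.2 p.1 := by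
    have hm : Measurable fun (p : ({k : Fin d // k ≠ i} → ℝ) × (Fin d → ℝ))
        (k : {k : Fin d // k ≠ i}) => h (p.1 k) (p.2 k) :=
      measurable_pi_lambda _ fun k => by
        have hk : Measurable fun p : ({k : Fin d // k ≠ i} → ℝ) × (Fin d → ℝ) =>
            (p.1 k, p.2 k) := by fun_prop
        exact hh.comp hk
    refine Measurable.ite ?_ (hφ.comp hm) measurable_const
    have hTm := hT.ordConnected.measurableSet
    measurability
  have hextm : ∀ u, Measurable (ext u) := fun u => measurable_extend hT (fun k => hsec _) hφ
  let avg : ({k : Fin d // k ≠ i} → ℝ) → ℝ := fun y => ∫ u, ext u y ∂(Measure.pi fun _ => ν)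
  have havg : Measurable avg := hext.stronglyMeasurable.integral_prod_right.measurable
  have havgC : ∀ y, |avg y| ≤ n := fun y =>
    abs_integral_le_of_abs_le fun u => abs_extend_le hφC y
  have havgm : Monotone avg := fun y z hyz => by
    have hi : ∀ y, Integrable (fun u => ext u y) (Measure.pi fun _ => ν) := fun y =>
      integrable_of_abs_le (hext.comp (measurable_const.prodMk measurable_id))
        fun u => abs_extend_le hφC y
    exact integral_mono (hi y) (hi z) fun u =>
      monotone_extend hT (fun k => hmono _) hφm hφC hyz
  obtain ⟨S, m, hS, hYS, hm, hcond⟩ := H i avg havg havgm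
    (integrable_of_abs_le (havg.comp (measurable_drop hY i)) fun _ => havgC _)
  obtain ⟨ψ, hψ, hψS, hcond⟩ := exists_measurable_monotoneOn hS hYS hm hcond
  have hcond' : condExp (MeasurableSpace.comap (Y i) inferInstance) P
      (fun ω => ∫ u : Fin d → ℝ, φ (fun k => h (Y k ω) (u k)) ∂(Measure.pi fun _ => ν))
      =ᵐ[P] fun ω => s * ψ (Y i ω) := by
    refine (condExp_congr_ae ?_).trans hcond
    filter_upwards [ae_all_iff.2 hYT] with ω hω
    refine integral_congr_ae (ae_of_all _ fun u => ?_)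
    exact (extend_of_mem (y := drop Y i ω) (f := fun (k : {k // k ≠ i}) y => h y (u k))
      fun k => hω k).symm
  have key := condExp_couple_eq hh hY hr i ((hrX i).mono fun p hp => hp.2) hφ hφC
    (hψ.const_mul s) hcond'
  refine ⟨S₀ ∩ r ⁻¹' S, fun x => ψ (r x), hS₀.inter (hr hS), ?_, ?_, key⟩
  · filter_upwards [hrX i, Measure.quasiMeasurePreserving_fst.ae hYS] with p h1 h2
    refine ⟨h1.1, ?_⟩
    rw [Set.mem_preimage, h1.2]
    exact h2
  · exact fun x hx y hy hxy => hψS hx.2 hy.2 (hrS₀ hx.1 hy.1 hxy)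

end Regression

/-! ### Inheritance of every concept -/

section Existence

variable {Ω : Type} [MeasurableSpace Ω] {d : ℕ} {P : Measure Ω} [IsProbabilityMeasure P]

/-- Every dependence concept is inherited by `h (Y_i, U_i)` for a suitable vector `U` with
marginals `ν` that is independent of `Y`: one with equal coordinates for positive association, and
one with independent coordinates in all other cases. -/
lemma Concept.Satisfies.exists_couple {D : Concept} {Y : Fin d → Ω → ℝ} (H : D.Satisfies P Y)
    {h : ℝ → ℝ → ℝ} {T : Set ℝ} {ν : Measure ℝ} [IsProbabilityMeasure ν]
    (hh : Measurable (Function.uncurry h)) (hY : ∀ i, Measurable (Y i)) (hT : IsUpperSet T)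
    (hYT : ∀ i, ∀ᵐ ω ∂P, Y i ω ∈ T) (hmono : ∀ u, MonotoneOn (fun y => h y u) T)
    (hmono' : ∀ y ∈ T, Monotone (h y)) {r : ℝ → ℝ} (hr : Measurable r) {S₀ : Set ℝ}
    (hS₀ : MeasurableSet S₀) (hrS₀ : MonotoneOn r S₀)
    (hrX : ∀ i, ∀ᵐ p ∂(P.prod (Measure.pi fun _ => ν)),
      couple h Y (fun i (u : Fin d → ℝ) => u i) i p ∈ S₀ ∧
      r (couple h Y (fun i (u : Fin d → ℝ) => u i) i p) = Y i p.1) :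
    ∃ (E : Type) (_ : MeasurableSpace E) (ρ : Measure E) (_ : IsProbabilityMeasure ρ)
      (U : Fin d → E → ℝ), (∀ i, Measurable (U i)) ∧ (∀ i, ρ.map (U i) = ν) ∧
        D.Satisfies (P.prod ρ) (couple h Y U) := by
  have hsec : ∀ v, Measurable fun y => h y v := fun v =>
    hh.comp (measurable_id.prodMk measurable_const)
  have indep : D.Satisfies (P.prod (Measure.pi fun _ => ν))
        (couple h Y fun i (u : Fin d → ℝ) => u i) →
      ∃ (E : Type) (_ : MeasurableSpace E) (ρ : Measure E) (_ : IsProbabilityMeasure ρ)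
        (U : Fin d → E → ℝ), (∀ i, Measurable (U i)) ∧ (∀ i, ρ.map (U i) = ν) ∧
          D.Satisfies (P.prod ρ) (couple h Y U) := fun hD =>
    ⟨Fin d → ℝ, inferInstance, Measure.pi fun _ => ν, inferInstance, fun i u => u i,
      fun i => measurable_pi_apply i, fun i => (measurePreserving_eval (fun _ => ν) i).map_eq, hD⟩
  cases D with
  | PA =>
    refine ⟨ℝ, inferInstance, ν, inferInstance, fun _ u => u, fun _ => measurable_id,
      fun _ => Measure.map_id, ?_⟩
    exact PA.couple hh hY hYT hmono' fun u =>
      PA.comp (f := fun _ y => h y u) hY hT hYT (fun _ => hmono u) (fun _ => hsec u) H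
  | NA =>
    exact indep <| NA.couple hh hY fun u =>
      NA.comp (f := fun i y => h y (u i)) hY hT hYT (fun i => hmono (u i)) (fun i => hsec (u i)) H
  | PRD =>
    exact indep <| regressionDependent_one_iff.1 <|
      (regressionDependent_one_iff.2 H).couple hh hY hT hYT hmono one_ne_zero hr hS₀ hrS₀ hrX
  | NRD =>
    exact indep <| regressionDependent_neg_one_iff.1 <|
      (regressionDependent_neg_one_iff.2 H).couple hh hY hT hYT hmono (by norm_num) hr hS₀ hrS₀ hrX
  | WPA =>
    exact indep <| WPA.couple hh hY fun u =>
      WPA.comp (f := fun i y => h y (u i)) hY hT hYT (fun i => hmono (u i)) (fun i => hsec (u i)) H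
  | WNA =>
    exact indep <| WNA.couple hh hY fun u =>
      WNA.comp (f := fun i y => h y (u i)) hY hT hYT (fun i => hmono (u i)) (fun i => hsec (u i)) H
  | POD =>
    exact indep <| POD.couple hh hY fun u =>
      POD.comp (f := fun i y => h y (u i)) hY hT hYT (fun i => hmono (u i)) H
  | NOD =>
    exact indep <| NOD.couple hh hY fun u =>
      NOD.comp (f := fun i y => h y (u i)) hY hT hYT (fun i => hmono (u i)) H
  | IN => exact indep <| iIndepFun_couple hh hY H

end Existence

/-! ### Randomized inverse of an increasing convex function -/

section Inverse

variable {I : Set ℝ} {f : ℝ → ℝ}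

/-- Slopes of a convex function increase, so a positive slope stays positive. Hence injectivity can
fail only among minimizers. -/
lemma lt_of_convexOn_of_lt (hconv : ConvexOn ℝ I f) (hmono : MonotoneOn f I) {z x x' : ℝ}
    (hz : z ∈ I) (hx : x ∈ I) (hx' : x' ∈ I) (hzx : f z < f x) (h : x < x') : f x < f x' := by
  have hlt : z < x := hmono.reflect_lt hz hx hzx
  have hs := hconv.slope_mono_adjacent hz hx' hlt h
  have : 0 < (f x' - f x) / (x' - x) := (div_pos (sub_pos.2 hzx) (sub_pos.2 hlt)).trans_le hs
  rwa [div_pos_iff_of_pos_right (sub_pos.2 h), sub_pos] at this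

/-- A positive slope forces at least linear growth, which makes the supremum in `genInverse`
meaningful. -/
lemma bddAbove_sublevel (hconv : ConvexOn ℝ I f) (hmono : MonotoneOn f I) {z x : ℝ}
    (hz : z ∈ I) (hx : x ∈ I) (hzx : f z < f x) (y : ℝ) : BddAbove {w | w ∈ I ∧ f w ≤ y} := by
  have hlt : z < x := hmono.reflect_lt hz hx hzx
  have hσ : 0 < (f x - f z) / (x - z) := div_pos (sub_pos.2 hzx) (sub_pos.2 hlt)
  -- The second term is where the line through `(z, f z)` and `(x, f x)` reaches height `y`.
  refine ⟨max x (x + (y - f x) / ((f x - f z) / (x - z))), fun w hw => ?_⟩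
  rcases le_or_gt w x with h | h
  · exact le_max_of_le_left h
  · refine le_max_of_le_right ?_
    have hs := hconv.slope_mono_adjacent hz hw.1 hlt h
    rw [le_div_iff₀ (sub_pos.2 h)] at hs
    rw [← sub_le_iff_le_add', le_div_iff₀ hσ, mul_comm]
    linarith [hw.2]

variable (I f)

/-- The values that are at least some value of `f` on `I`. -/
def upperValues : Set ℝ := {y | ∃ x ∈ I, f x ≤ y}

/-- The generalized inverse of `f` on `I`. -/
noncomputable def genInverse : ℝ → ℝ :=
  (upperValues I f).indicator fun y => sSup {x | x ∈ I ∧ f x ≤ y}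

open Classical in
/-- The generalized inverse of `f`, with the value at the minimum of `f` randomized by `u`. -/
noncomputable def randInverse (y u : ℝ) : ℝ :=
  if y ∈ lowerBounds (f '' I) then min u (genInverse I f y) else genInverse I f y

variable {I f}

lemma isUpperSet_upperValues : IsUpperSet (upperValues I f) :=
  fun _ _ hab ⟨x, hx, hfx⟩ => ⟨x, hx, hfx.trans hab⟩

lemma isLowerSet_lowerBounds_image : IsLowerSet (lowerBounds (f '' I)) :=
  fun _ _ hab ha => lowerBounds_mono_mem hab ha

lemma mem_upperValues {x : ℝ} (hx : x ∈ I) : f x ∈ upperValues I f := ⟨x, hx, le_rfl⟩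

lemma genInverse_of_mem {y : ℝ} (hy : y ∈ upperValues I f) :
    genInverse I f y = sSup {x | x ∈ I ∧ f x ≤ y} := Set.indicator_of_mem hy _

variable (hB : ∀ y, BddAbove {x | x ∈ I ∧ f x ≤ y})
include hB

lemma monotoneOn_genInverse : MonotoneOn (genInverse I f) (upperValues I f) := by
  intro y hy z hz hyz
  rw [genInverse_of_mem hy, genInverse_of_mem hz]
  exact csSup_le_csSup (hB z) hy fun x hx => ⟨hx.1, hx.2.trans hyz⟩

/-- The `min` in `randInverse` gives monotonicity in `y` for every real `u`, not only for minimizers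
`u`: the randomized value never exceeds `genInverse`. -/
lemma randInverse_le_randInverse {y y' u u' : ℝ} (hy : y ∈ upperValues I f) (hyy' : y ≤ y')
    (huu' : u ≤ u') : randInverse I f y u ≤ randInverse I f y' u' := by
  have hg := monotoneOn_genInverse hB hy (isUpperSet_upperValues hyy' hy) hyy'
  unfold randInverse
  split_ifs with h1 h2 h2
  · exact min_le_min huu' hg
  · exact (min_le_right _ _).trans hg
  · exact absurd (isLowerSet_lowerBounds_image hyy' h2) h1
  · exact hg

lemma measurable_randInverse : Measurable (Function.uncurry (randInverse I f)) := by
  have hg : Measurable (genInverse I f) := by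
    have hm := measurable_indicator_of_monotoneOn
      isUpperSet_upperValues.ordConnected.measurableSet (monotoneOn_genInverse hB)
    rwa [genInverse, Set.indicator_indicator, Set.inter_self, ← genInverse] at hm
  have hL : MeasurableSet (lowerBounds (f '' I)) :=
    isLowerSet_lowerBounds_image.ordConnected.measurableSet
  exact Measurable.ite (measurable_fst hL) (measurable_snd.min (hg.comp measurable_fst))
    (hg.comp measurable_fst)

/-- Randomized inversion recovers `x` from `f x`, except that a minimizer `x` is replaced by the
minimizer `u`. -/
lemma randInverse_apply (hconv : ConvexOn ℝ I f) (hmono : MonotoneOn f I) {x u : ℝ} (hx : x ∈ I)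
    (hu : f x ∈ lowerBounds (f '' I) → u ∈ I ∧ f u ∈ lowerBounds (f '' I)) :
    (f x ∈ lowerBounds (f '' I) → randInverse I f (f x) u = u) ∧
    (f x ∉ lowerBounds (f '' I) → randInverse I f (f x) u = x) ∧
    randInverse I f (f x) u ∈ I ∧ f (randInverse I f (f x) u) = f x := by
  by_cases h : f x ∈ lowerBounds (f '' I)
  · obtain ⟨huI, huL⟩ := hu h
    have hfu : f u ≤ f x := huL (Set.mem_image_of_mem f hx)
    have e : randInverse I f (f x) u = u := by
      rw [randInverse, if_pos h, genInverse_of_mem (mem_upperValues hx)]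
      exact min_eq_left (le_csSup (hB _) ⟨huI, hfu⟩)
    rw [e]
    exact ⟨fun _ => rfl, fun h' => absurd h h', huI,
      le_antisymm hfu (h (Set.mem_image_of_mem f huI))⟩
  · have e : randInverse I f (f x) u = x := by
      rw [randInverse, if_neg h, genInverse_of_mem (mem_upperValues hx)]
      -- Above the minimum, `f` is strictly increasing to the right of `x`, so `x` is the largest
      -- point of its own sublevel set.
      refine IsGreatest.csSup_eq ⟨⟨hx, le_rfl⟩, fun w hw => ?_⟩
      simp only [lowerBounds, Set.mem_image, forall_exists_index, and_imp,
        forall_apply_eq_imp_iff₂, Set.mem_ofPred_eq, not_forall, not_le] at h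
      obtain ⟨z, hz, hzx⟩ := h
      by_contra hlt
      exact absurd hw.2 (lt_of_convexOn_of_lt hconv hmono hz hx hw.1 hzx (not_le.1 hlt)).not_ge
    rw [e]
    exact ⟨fun h' => absurd h' h, fun _ => rfl, hx, rfl⟩

end Inverse

/-! ### Law of the randomized inverse -/

section Law

variable {F : Measure ℝ} {I : Set ℝ} {f : ℝ → ℝ}

open Classical in
/-- The distribution `F` conditioned on the set of minimizers of `f` on `I`. -/
noncomputable def minimizerLaw (F : Measure ℝ) (I : Set ℝ) (f : ℝ → ℝ) : Measure ℝ :=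
  if F (f ⁻¹' lowerBounds (f '' I)) = 0 then Measure.dirac 0
  else cond F (f ⁻¹' lowerBounds (f '' I))

instance [IsFiniteMeasure F] : IsProbabilityMeasure (minimizerLaw F I f) := by
  unfold minimizerLaw
  split_ifs with h
  · infer_instance
  · exact cond_isProbabilityMeasure h

variable (hf : Measurable f) (hI : ∀ᵐ x ∂F, x ∈ I)
include hf hI

lemma ae_prod_minimizerLaw [IsFiniteMeasure F] : ∀ᵐ p ∂(F.prod (minimizerLaw F I f)),
    p.1 ∈ I ∧ (f p.1 ∈ lowerBounds (f '' I) → p.2 ∈ I ∧ f p.2 ∈ lowerBounds (f '' I)) := by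
  have hK : MeasurableSet (f ⁻¹' lowerBounds (f '' I)) :=
    hf isLowerSet_lowerBounds_image.ordConnected.measurableSet
  have h1 : ∀ᵐ p ∂(F.prod (minimizerLaw F I f)), p.1 ∈ I :=
    Measure.quasiMeasurePreserving_fst.ae hI
  by_cases h0 : F (f ⁻¹' lowerBounds (f '' I)) = 0
  · have h2 : ∀ᵐ p ∂(F.prod (minimizerLaw F I f)), p.1 ∉ f ⁻¹' lowerBounds (f '' I) :=
      Measure.quasiMeasurePreserving_fst.ae (measure_eq_zero_iff_ae_notMem.1 h0)
    filter_upwards [h1, h2] with p hp1 hp2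
    exact ⟨hp1, fun h => absurd h hp2⟩
  · have h2 : ∀ᵐ u ∂(minimizerLaw F I f), u ∈ I ∧ f u ∈ lowerBounds (f '' I) := by
      rw [minimizerLaw, if_neg h0]
      filter_upwards [cond_absolutelyContinuous.ae_le hI, ae_cond_mem hK] with u h1 h2
      exact ⟨h1, h2⟩
    filter_upwards [h1, Measure.quasiMeasurePreserving_snd.ae h2] with p hp1 hp2
    exact ⟨hp1, fun _ => hp2⟩

/-- Replacing a minimizer by an independent draw from `F` conditioned on the minimizers `K` keeps
the law: `F(K) F(B | K) + F(B \ K) = F(B)`. -/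
lemma map_randInverse [IsFiniteMeasure F] (hB : ∀ y, BddAbove {x | x ∈ I ∧ f x ≤ y})
    (hconv : ConvexOn ℝ I f) (hmono : MonotoneOn f I) :
    (F.prod (minimizerLaw F I f)).map (fun p => randInverse I f (f p.1) p.2) = F := by
  set K := f ⁻¹' lowerBounds (f '' I) with hKdef
  have hK : MeasurableSet K := hf isLowerSet_lowerBounds_image.ordConnected.measurableSet
  have hm : Measurable fun p : ℝ × ℝ => randInverse I f (f p.1) p.2 :=
    (measurable_randInverse hB).comp ((hf.comp measurable_fst).prodMk measurable_snd)
  ext B hBm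
  rw [Measure.map_apply hm hBm]
  have e : (F.prod (minimizerLaw F I f)) ((fun p => randInverse I f (f p.1) p.2) ⁻¹' B)
      = (F.prod (minimizerLaw F I f)) (K ×ˢ B ∪ (B \ K) ×ˢ Set.univ) := by
    refine measure_congr ?_
    filter_upwards [ae_prod_minimizerLaw hf hI] with p hp
    obtain ⟨h1, h2, -, -⟩ := randInverse_apply hB hconv hmono hp.1 hp.2
    refine propext ?_
    change randInverse I f (f p.1) p.2 ∈ B ↔ (p.1 ∈ K ∧ p.2 ∈ B) ∨ ((p.1 ∈ B ∧ p.1 ∉ K) ∧ True)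
    by_cases h : p.1 ∈ K
    · rw [h1 h]; simp [h]
    · rw [h2 h]; simp [h]
  rw [e, measure_union _ ((hBm.diff hK).prod MeasurableSet.univ), Measure.prod_prod,
    Measure.prod_prod, measure_univ, mul_one]
  · have h : F K * minimizerLaw F I f B = F (B ∩ K) := by
      by_cases h0 : F K = 0
      · rw [h0, zero_mul, measure_mono_null Set.inter_subset_right h0]
      · rw [minimizerLaw, if_neg h0, cond_apply hK, ← mul_assoc,
          ENNReal.mul_inv_cancel h0 (measure_ne_top _ _), one_mul, Set.inter_comm]
    rw [h, measure_inter_add_sdiff B hK]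
  · rw [Set.disjoint_left]
    rintro p ⟨hp1, -⟩ ⟨hp2, -⟩
    exact hp2.2 hp1

end Law

/-! ### Transfer of the order and conclusion -/

section Closure

variable {D : Concept} {d : ℕ} {F : Measure ℝ} {I : Set ℝ} {f : ℝ → ℝ}

lemma stLE_map_of_const {Ω : Type*} [MeasurableSpace Ω] {P : Measure Ω} {Y : Fin d → Ω → ℝ}
    (hY : ∀ i, Measurable (Y i)) {G : Measure ℝ} (hG : ∀ i, P.map (Y i) = G) {c : ℝ}
    (hc : ∀ᵐ y ∂G, y = c) {θ : Fin d → ℝ} (hθ : θ ∈ stdSimplex ℝ (Fin d)) :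
    StLE G (P.map fun ω => ∑ i, θ i * Y i ω) := by
  have hYc : ∀ i, ∀ᵐ ω ∂P, Y i ω = c := fun i =>
    ae_of_ae_map (hY i).aemeasurable (by rwa [hG i])
  obtain ⟨i, -⟩ : ∃ i, θ i ≠ 0 := by
    by_contra! h
    simpa [h] using hθ.2
  have e : (fun ω => ∑ i, θ i * Y i ω) =ᵐ[P] Y i := by
    filter_upwards [ae_all_iff.2 hYc] with ω hω
    simp [hω, ← Finset.sum_mul, hθ.2]
  rw [Measure.map_congr e, hG i]
  exact fun x => le_rfl

/-- Transfer of the stochastic order from the `X_i` to the `f (X_i)`. -/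
lemma stLE_map_of_convexOn [IsProbabilityMeasure F] (hf : Measurable f) (hI : ∀ᵐ x ∂F, x ∈ I)
    (hmono : MonotoneOn f I) (hconv : ConvexOn ℝ I f) {Ω : Type*} [MeasurableSpace Ω]
    {Q : Measure Ω} [IsProbabilityMeasure Q] {X Y : Fin d → Ω → ℝ} (hX : ∀ i, Measurable (X i))
    (hY : ∀ i, Measurable (Y i)) (hXY : ∀ i, ∀ᵐ ω ∂Q, X i ω ∈ I ∧ f (X i ω) = Y i ω)
    {θ : Fin d → ℝ} (hθ : θ ∈ stdSimplex ℝ (Fin d))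
    (h : StLE F (Q.map fun ω => ∑ i, θ i * X i ω)) :
    StLE (F.map f) (Q.map fun ω => ∑ i, θ i * Y i ω) := by
  intro y
  have hsX : Measurable fun ω => ∑ i, θ i * X i ω := by fun_prop
  have hsY : Measurable fun ω => ∑ i, θ i * Y i ω := by fun_prop
  have : IsProbabilityMeasure (Q.map fun ω => ∑ i, θ i * X i ω) :=
    Measure.isProbabilityMeasure_map hsX.aemeasurable
  -- The upward closure of the points of `I` where `f` exceeds `y`; on `I` it adds nothing.
  let W : Set ℝ := {w | ∃ v ∈ I, y < f v ∧ v ≤ w}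
  have hW : IsUpperSet W := fun a b hab ⟨v, hv, hyv, hva⟩ => ⟨v, hv, hyv, hva.trans hab⟩
  have hWI : ∀ x ∈ I, (x ∈ W ↔ y < f x) := fun x hx =>
    ⟨fun ⟨v, hv, hyv, hvx⟩ => hyv.trans_le (hmono hv hx hvx), fun hyx => ⟨x, hx, hyx, le_rfl⟩⟩
  rw [Measure.map_apply hf measurableSet_Ioi, Measure.map_apply hsY measurableSet_Ioi]
  calc F (f ⁻¹' Set.Ioi y) = F W := by
        refine measure_congr ?_
        filter_upwards [hI] with x hx using propext (hWI x hx).symm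
    _ ≤ (Q.map fun ω => ∑ i, θ i * X i ω) W := h.le_of_isUpperSet hW
    _ = Q ((fun ω => ∑ i, θ i * X i ω) ⁻¹' W) :=
        Measure.map_apply hsX hW.ordConnected.measurableSet
    _ ≤ Q ((fun ω => ∑ i, θ i * Y i ω) ⁻¹' Set.Ioi y) := by
        refine measure_mono_ae ?_
        filter_upwards [ae_all_iff.2 hXY] with ω hω hωW
        have hmem : ∑ i, θ i * X i ω ∈ I :=
          hconv.1.sum_mem (fun i _ => hθ.1 i) hθ.2 fun i _ => (hω i).1
        have hle : f (∑ i, θ i * X i ω) ≤ ∑ i, θ i * Y i ω := by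
          refine (hconv.map_sum_le (fun i _ => hθ.1 i) hθ.2 fun i _ => (hω i).1).trans_eq ?_
          exact Finset.sum_congr rfl fun i _ => by rw [(hω i).2, smul_eq_mul]
        exact ((hWI _ hmem).1 hωW).trans_le hle

/-- The class is closed under increasing convex transforms by Borel functions. -/
lemma map_mem_diversificationClass_of_measurable (hF : F ∈ diversificationClass D d)
    (hf : Measurable f) (hIm : MeasurableSet I) (hI : ∀ᵐ x ∂F, x ∈ I) (hmono : MonotoneOn f I)
    (hconv : ConvexOn ℝ I f) : F.map f ∈ diversificationClass D d := by
  obtain ⟨hFp, hF⟩ := hF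
  refine ⟨Measure.isProbabilityMeasure_map hf.aemeasurable, ?_⟩
  intro Ω _ P _ Y hY hYF hD θ hθ
  -- If `f` is constant on `I`, sublevel sets may be unbounded and the inverse is unavailable, but
  -- then all `Y i` equal the same constant.
  by_cases hc : ∃ z ∈ I, ∃ x ∈ I, f z < f x
  swap
  · push Not at hc
    obtain ⟨x₀, hx₀⟩ := hI.exists
    refine stLE_map_of_const hY hYF (c := f x₀) ?_ hθ
    refine (ae_map_iff hf.aemeasurable (measurableSet_singleton (f x₀))).2 ?_
    filter_upwards [hI] with x hx using le_antisymm (hc x₀ hx₀ x hx) (hc x hx x₀ hx₀)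
  obtain ⟨z, hz, x, hx, hzx⟩ := hc
  have hB := bddAbove_sublevel hconv hmono hz hx hzx
  have hh := measurable_randInverse hB
  set ν := minimizerLaw F I f
  -- The pair `(Y i, U)` has the law of `(f x, u)` under `F.prod ν`, so almost sure identities and
  -- the law of the inverse can be verified there, where `x` itself is at hand.
  have hpair : ∀ {E : Type} [MeasurableSpace E] (ρ : Measure E) [IsProbabilityMeasure ρ]
      (U : E → ℝ), Measurable U → ρ.map U = ν → ∀ i,
      (P.prod ρ).map (fun p => (Y i p.1, U p.2)) = (F.prod ν).map fun p => (f p.1, p.2) := by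
    intro E _ ρ _ U hU hUν i
    have e1 := Measure.map_prod_map P ρ (hY i) hU
    have e2 := Measure.map_prod_map F ν hf measurable_id
    rw [hYF, hUν] at e1
    rw [Measure.map_id] at e2
    exact e1.symm.trans e2
  have hrec : ∀ {E : Type} [MeasurableSpace E] (ρ : Measure E) [IsProbabilityMeasure ρ]
      (U : E → ℝ), Measurable U → ρ.map U = ν → ∀ i, ∀ᵐ p ∂(P.prod ρ),
      randInverse I f (Y i p.1) (U p.2) ∈ I ∧
        f (randInverse I f (Y i p.1) (U p.2)) = Y i p.1 := by
    intro E _ ρ _ U hU hUν i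
    have hm1 : Measurable fun p : Ω × E => (Y i p.1, U p.2) :=
      ((hY i).comp measurable_fst).prodMk (hU.comp measurable_snd)
    have hm2 : Measurable fun p : ℝ × ℝ => (f p.1, p.2) :=
      (hf.comp measurable_fst).prodMk measurable_snd
    have hset : MeasurableSet {q : ℝ × ℝ | randInverse I f q.1 q.2 ∈ I ∧
        f (randInverse I f q.1 q.2) = q.1} :=
      (hh hIm).inter (measurableSet_eq_fun (hf.comp hh) measurable_fst)
    refine ae_of_ae_map (p := fun q => randInverse I f q.1 q.2 ∈ I ∧
      f (randInverse I f q.1 q.2) = q.1) hm1.aemeasurable ?_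
    rw [hpair ρ U hU hUν i, ae_map_iff hm2.aemeasurable hset]
    filter_upwards [ae_prod_minimizerLaw hf hI] with p hp
    exact (randInverse_apply hB hconv hmono hp.1 hp.2).2.2
  have hYT : ∀ i, ∀ᵐ ω ∂P, Y i ω ∈ upperValues I f := fun i => by
    refine ae_of_ae_map (p := fun y => y ∈ upperValues I f) (hY i).aemeasurable ?_
    rw [hYF]
    refine (ae_map_iff hf.aemeasurable
      isUpperSet_upperValues.ordConnected.measurableSet).2 ?_
    filter_upwards [hI] with x hx using mem_upperValues hx
  -- The map recovering `Y i` from `X i` is `f` itself, increasing on `I`.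
  obtain ⟨E, _, ρ, _, U, hU, hUν, hDX⟩ := hD.exists_couple (ν := ν) hh hY isUpperSet_upperValues
    hYT (fun u y hy y' _ hyy' => randInverse_le_randInverse hB hy hyy' le_rfl)
    (fun y hy u u' huu' => randInverse_le_randInverse hB hy le_rfl huu') hf hIm hmono
    fun i => hrec _ (fun u : Fin d → ℝ => u i) (measurable_pi_apply i)
      (measurePreserving_eval (fun _ => ν) i).map_eq i
  have hX := measurable_couple hh hY hU
  have hXF : ∀ i, (P.prod ρ).map (couple (randInverse I f) Y U i) = F := fun i => by
    have hm1 : Measurable fun p : Ω × E => (Y i p.1, U i p.2) :=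
      ((hY i).comp measurable_fst).prodMk ((hU i).comp measurable_snd)
    have hm2 : Measurable fun p : ℝ × ℝ => (f p.1, p.2) :=
      (hf.comp measurable_fst).prodMk measurable_snd
    have e := congrArg (Measure.map (Function.uncurry (randInverse I f)))
      (hpair ρ (U i) (hU i) (hUν i) i)
    rw [Measure.map_map hh hm1, Measure.map_map hh hm2] at e
    exact e.trans (map_randInverse hf hI hB hconv hmono)
  have key := stLE_map_of_convexOn hf hI hmono hconv (Q := P.prod ρ) hX
    (Y := fun i p => Y i p.1)
    (fun i => (hY i).comp measurable_fst) (fun i => hrec ρ (U i) (hU i) (hUν i) i) hθ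
    (hF _ (P.prod ρ) _ hX hXF hDX θ hθ)
  have hsum : Measurable fun ω => ∑ i, θ i * Y i ω := by fun_prop
  have e : (P.prod ρ).map (fun p => ∑ i, θ i * Y i p.1) = P.map fun ω => ∑ i, θ i * Y i ω := by
    rw [← Function.comp_def (fun ω => ∑ i, θ i * Y i ω) Prod.fst,
      ← Measure.map_map hsum measurable_fst, Measure.map_fst_prod, measure_univ, one_smul]
  rwa [e] at key

end Closure

end DiversificationPenalty

open DiversificationPenalty MeasureTheory in
theorem mainTheorem5 (D : Concept) (d : ℕ) (hd : 2 ≤ d) (F : Measure ℝ)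
    (hF : F ∈ diversificationClass D d) (I : Set ℝ) (hI : ∀ᵐ x ∂F, x ∈ I) (f : ℝ → ℝ)
    (hmono : MonotoneOn f I) (hconv : ConvexOn ℝ I f) :
    F.map f ∈ diversificationClass D d := by
  have hIm : MeasurableSet I := hconv.1.ordConnected.measurableSet
  -- Off `I` nothing is known about `f`, not even measurability; its indicator version is Borel and
  -- agrees with it on `I`.
  have heq : Set.EqOn f (I.indicator f) I := fun x hx => (Set.indicator_of_mem hx f).symm
  have hae : f =ᵐ[F] I.indicator f := hI.mono fun x hx => heq hx
  rw [Measure.map_congr hae]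
  exact map_mem_diversificationClass_of_measurable hF
    (measurable_indicator_of_monotoneOn hIm hmono) hIm hI (hmono.congr heq) (hconv.congr heq)
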